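/- **Setting.** Fix $K\ge 1$ and $\beta\in\mathbb{R}^K$. Let $Q$ be the law of a pair $(x,\epsilon)\in\mathbb{R}^K\times\mathbb{R}$ with finite second moments such that $\Sigma=\mathbb{E}[xx^\top]$ is positive definite, $\mathbb{E}[\epsilon]=0$, $\mathbb{E}[x\epsilon]=0$ and $\mathbb{E}[\epsilon^2\mid x]=\sigma^2$ almost surely, with $0<\sigma<\infty$. For each sample size $n$, on some probability space, let $(x_i,\epsilon_i)_{i\le n}$ be i.i.d. with law $Q$ ($Q$ does not depend on $n$), let $\alpha=(\alpha_1,\dots,\alpha_n)^\top$ be a random vector whose dependence with $(x_i,\epsilon_i)_{i\le n}$ is unrestricted, with $\mathbb{P}(\alpha_i\neq 0)=p=p_n$ for every $i$, and observe $$y_i=x_i^\top\beta+\alpha_i+\epsilon_i,\qquad i=1,\dots,n .$$ Let $X$ be the $n\times K$ matrix with rows $x_i^\top$, $P_X$ the orthogonal projector on the span of the columns of $X$ and $M_X=I_n-P_X$; let $\|X\|_\infty$ be the largest absolute value of an entry of $X$, and $\|\cdot\|_1,\|\cdot\|_2,\|\cdot\|_\infty$ the usual norms of vectors. For a (possibly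 random) penalty level $\lambda=\lambda_n$ let $(\widehat\beta,\widehat\alpha)$ be random vectors with $$(\widehat\beta,\widehat\alpha)\in\arg\min_{b\in\mathbb{R}^K,\,a\in\mathbb{R}^n}\ \frac1{\sqrt n}\|y-Xb-a\|_2+\frac{\lambda}{n}\|a\|_1\quad\text{almost surely.}$$ **Theorem 2.** Assume, as $n\to\infty$, 1. $\mathbb{P}\left(\lambda\ge 2\sqrt n\,\dfrac{\|M_X\epsilon\|_\infty}{\|M_X\epsilon\|_2}\right)\to 1$; 2. $p\max\left(\lambda,\sqrt{\|X\|_\infty}\right)=o_P(1)$; 3. $p\,\lambda\,\|X\|_\infty\sqrt n=o_P(1)$. Then $$\sqrt n\,(\widehat\beta-\beta)\xrightarrow{d}\mathcal N(0,\sigma^2\Sigma^{-1}).$$ Moreover $\widehat\sigma^2=\frac1n\sum_{i=1}^n(y_i-x_i^\top\widehat\beta-\widehat\alpha_i)^2$ and $\widehat\Sigma=\frac1nX^\top X$ are consistent: $\widehat\sigma^2\to\sigma^2$ and $\widehat\Sigma\to\Sigma$ in probability. -/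

import Mathlib

open MeasureTheory ProbabilityTheory Filter Topology
open scoped Matrix

noncomputable section

namespace OutlierRegression

/-! ### Asymptotics along a sequence of probability spaces -/

section Asymptotics

variable {Ω : ℕ → Type*} [∀ n, MeasurableSpace (Ω n)]

/-- `Z n = o_P(1)`: for every `δ > 0`, `P_n(|Z n| ≥ δ) → 0`.  Each sample size has its own
probability space. -/
def IsLittleOPOne (μ : ∀ n, Measure (Ω n)) (Z : ∀ n, Ω n → ℝ) : Prop :=
  ∀ δ : ℝ, 0 < δ → Tendsto (fun n => μ n {ω | δ ≤ |Z n ω|}) atTop (𝓝 0)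

/-- The events `E n` happen with probability approaching one: the probability that `E n` fails
tends to `0`. -/
def WithProbApproachingOne (μ : ∀ n, Measure (Ω n)) (E : ∀ n, Set (Ω n)) : Prop :=
  Tendsto (fun n => μ n (E n)ᶜ) atTop (𝓝 0)

end Asymptotics

/-! ### Norms -/

/-- The `ℓ₁` norm of a vector of `ℝⁿ`. -/
def l1Norm {n : ℕ} (v : EuclideanSpace ℝ (Fin n)) : ℝ := ∑ i, |v i|

/-- The sup norm of a vector of `ℝⁿ`: the largest absolute value of a coordinate
(the norm of `Fin n → ℝ` is the sup norm). -/
def vecSupNorm {n : ℕ} (v : EuclideanSpace ℝ (Fin n)) : ℝ := ‖(fun i => v i : Fin n → ℝ)‖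

/-- The sup norm of a matrix: the largest absolute value of an entry. -/
def matSupNorm {m k : ℕ} (M : Matrix (Fin m) (Fin k) ℝ) : ℝ :=
  ‖(fun i j => M i j : Fin m → Fin k → ℝ)‖

/-! ### The regression model -/

/-- The design matrix `X = (x₁, …, xₙ)ᵀ`, whose `i`-th row is `xᵢ`. -/
def designMatrix {n K : ℕ} (x : Fin n → EuclideanSpace ℝ (Fin K)) :
    Matrix (Fin n) (Fin K) ℝ :=
  Matrix.of fun i k => x i k

/-- The vector `X b` of `ℝⁿ`. -/
def fitted {n K : ℕ} (X : Matrix (Fin n) (Fin K) ℝ) (b : EuclideanSpace ℝ (Fin K)) :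
    EuclideanSpace ℝ (Fin n) :=
  WithLp.toLp 2 (X *ᵥ WithLp.ofLp b)

/-- The linear span of the columns of `X` in `ℝⁿ`. -/
def columnSpan {n K : ℕ} (X : Matrix (Fin n) (Fin K) ℝ) :
    Submodule ℝ (EuclideanSpace ℝ (Fin n)) :=
  Submodule.span ℝ (Set.range fun k : Fin K => WithLp.toLp 2 fun i => X i k)

/-- `M_X v = v - P_X v`, with `P_X` the orthogonal projector on the span of the columns of `X`. -/
def residualMaker {n K : ℕ} (X : Matrix (Fin n) (Fin K) ℝ) (v : EuclideanSpace ℝ (Fin n)) :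
    EuclideanSpace ℝ (Fin n) :=
  v - (columnSpan X).starProjection v

/-- The outcome vector `y = X β + α + ε`. -/
def outcome {n K : ℕ} (X : Matrix (Fin n) (Fin K) ℝ) (β : EuclideanSpace ℝ (Fin K))
    (α ε : EuclideanSpace ℝ (Fin n)) : EuclideanSpace ℝ (Fin n) :=
  fitted X β + α + ε

/-- The matrix `E[x xᵀ]` when `(x, ε)` has law `Q`. -/
def secondMoment {K : ℕ} (Q : Measure (EuclideanSpace ℝ (Fin K) × ℝ)) :
    Matrix (Fin K) (Fin K) ℝ :=
  Matrix.of fun j k => ∫ z, z.1 j * z.1 k ∂Q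

/-! ### The estimators -/

/-- The objective of the square-root lasso that penalizes only `a`:
`‖y - X b - a‖₂ / √n + (lam / n) ‖a‖₁`. -/
def sqrtLassoObjective {n K : ℕ} (lam : ℝ) (X : Matrix (Fin n) (Fin K) ℝ)
    (y : EuclideanSpace ℝ (Fin n)) (b : EuclideanSpace ℝ (Fin K))
    (a : EuclideanSpace ℝ (Fin n)) : ℝ :=
  1 / √(n : ℝ) * ‖y - fitted X b - a‖ + lam / n * l1Norm a

/-- `(b, a)` minimizes the square-root lasso objective over `ℝᴷ × ℝⁿ`. -/
def IsSqrtLasso {n K : ℕ} (lam : ℝ) (X : Matrix (Fin n) (Fin K) ℝ)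
    (y : EuclideanSpace ℝ (Fin n)) (b : EuclideanSpace ℝ (Fin K))
    (a : EuclideanSpace ℝ (Fin n)) : Prop :=
  ∀ (b' : EuclideanSpace ℝ (Fin K)) (a' : EuclideanSpace ℝ (Fin n)),
    sqrtLassoObjective lam X y b a ≤ sqrtLassoObjective lam X y b' a'

/-- The mean squared residual `(1/n) ∑ᵢ (yᵢ - xᵢᵀ b - aᵢ)²`. -/
def meanSquaredResidual {n K : ℕ} (X : Matrix (Fin n) (Fin K) ℝ)
    (y : EuclideanSpace ℝ (Fin n)) (b : EuclideanSpace ℝ (Fin K))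
    (a : EuclideanSpace ℝ (Fin n)) : ℝ :=
  1 / (n : ℝ) * ∑ i, (y i - fitted X b i - a i) ^ 2

/-- The empirical second moment matrix `(1/n) Xᵀ X`. -/
def sampleSecondMoment {n K : ℕ} (X : Matrix (Fin n) (Fin K) ℝ) : Matrix (Fin K) (Fin K) ℝ :=
  (1 / (n : ℝ)) • (Xᵀ * X)

end OutlierRegression

end

open OutlierRegression

/-! Write `u = M_X ε`, `d = α̂ - α`, `g = M_X d`, and let `s` be the number of nonzero `α_i`.
Minimizing over `b` makes the residual `M_X (y - α̂) = u - g`, so the slope drops out and `α̂` is a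
square-root lasso for the design `M_X`.

Comparing `α̂` with `α`, and using that the penalty dominates the noise, gives the cone condition
`‖d‖₁ ≤ 4 ‖d_J‖₁`, with `J` the support of `α`. Since `X` has only `K` columns and bounded entries,
`P_X` can absorb at most half of such a `d`: this replaces a restricted eigenvalue assumption. A
quadratic inequality then gives `‖g‖ ≲ (λ √s / √n) ‖u‖` and `‖d‖₁ ≲ (λ s / √n) ‖u‖`
(`IsSqrtLasso.oracle`).

The slope solves `XᵀX (β̂ - β) = Xᵀε - Xᵀd`. As `‖u‖` is of order `√n`, the bias `‖Xᵀd‖ / √n` is at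
most a constant times `T = λ ‖X‖_∞ s / √n`, and so is the effect of `g` on the mean squared residual
(`IsSqrtLasso.rates`). Markov's inequality gives `s = O_P(n p)` whatever the dependence of `α` on
the data, hence `T = O_P(p λ ‖X‖_∞ √n) = o_P(1)`.

What remains is the regression without outliers: law of large numbers for `XᵀX / n` and `‖ε‖² / n`,
central limit theorem for `Xᵀε / √n`, and Slutsky's theorem. As `Q` is fixed, the limit theorems for
the array are read off one infinite i.i.d. sequence (`map_sample_eq`). -/

noncomputable section

namespace OutlierRegression

/-! ### Calculus of stochastic orders -/

section StochasticOrders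

variable {Ω : ℕ → Type*} [∀ n, MeasurableSpace (Ω n)] {μ : ∀ n, Measure (Ω n)}
  {E F : ∀ n, Set (Ω n)} {Z W : ∀ n, Ω n → ℝ}

/-- `Z n = O_P(1)`: the sequence is bounded in probability. -/
def IsBigOPOne (μ : ∀ n, Measure (Ω n)) (Z : ∀ n, Ω n → ℝ) : Prop :=
  ∀ η : ENNReal, 0 < η → ∃ M : ℝ, 0 < M ∧ ∀ᶠ n in atTop, μ n {ω | M ≤ |Z n ω|} ≤ η

theorem WithProbApproachingOne.mono (hE : WithProbApproachingOne μ E)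
    (h : ∀ᶠ n in atTop, E n ⊆ F n) : WithProbApproachingOne μ F :=
  tendsto_of_tendsto_of_tendsto_of_le_of_le' tendsto_const_nhds hE
    (Eventually.of_forall fun _ => zero_le) (h.mono fun _ hn =>
      measure_mono (Set.compl_subset_compl.2 hn))

theorem WithProbApproachingOne.inter (hE : WithProbApproachingOne μ E)
    (hF : WithProbApproachingOne μ F) : WithProbApproachingOne μ fun n => E n ∩ F n := by
  have h := Tendsto.add hE hF
  rw [add_zero] at h
  refine tendsto_of_tendsto_of_tendsto_of_le_of_le tendsto_const_nhds h
    (fun _ => zero_le) fun n => ?_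
  simp only [Set.compl_inter]
  exact measure_union_le _ _

theorem WithProbApproachingOne.of_ae (h : ∀ n, ∀ᵐ ω ∂(μ n), ω ∈ E n) :
    WithProbApproachingOne μ E := by
  have : (fun n => μ n (E n)ᶜ) = fun _ => 0 := funext fun n => h n
  unfold WithProbApproachingOne
  rw [this]
  exact tendsto_const_nhds

theorem IsLittleOPOne.abs_lt (hZ : IsLittleOPOne μ Z) {δ : ℝ} (hδ : 0 < δ) :
    WithProbApproachingOne μ fun n => {ω | |Z n ω| < δ} := by
  have := hZ δ hδ
  refine this.congr fun n => ?_
  congr 1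
  ext ω
  simp

theorem isLittleOPOne_iff :
    IsLittleOPOne μ Z ↔
      ∀ δ : ℝ, 0 < δ → WithProbApproachingOne μ fun n => {ω | |Z n ω| < δ} := by
  refine ⟨fun h δ hδ => h.abs_lt hδ, fun h δ hδ => (h δ hδ).congr fun n => ?_⟩
  congr 1
  ext ω
  simp

/-- Domination is required only on events of probability approaching one; this is how deterministic
inequalities valid on good events become stochastic rates. -/
theorem IsLittleOPOne.of_le (hW : IsLittleOPOne μ W) (hE : WithProbApproachingOne μ E)
    (h : ∀ᶠ n in atTop, ∀ ω ∈ E n, |Z n ω| ≤ |W n ω|) : IsLittleOPOne μ Z := by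
  rw [isLittleOPOne_iff]
  intro δ hδ
  refine (hE.inter (hW.abs_lt hδ)).mono (h.mono fun n hn ω hω => ?_)
  exact (hn ω hω.1).trans_lt hω.2

theorem IsLittleOPOne.add (hZ : IsLittleOPOne μ Z) (hW : IsLittleOPOne μ W) :
    IsLittleOPOne μ fun n ω => Z n ω + W n ω := by
  rw [isLittleOPOne_iff]
  intro δ hδ
  refine ((hZ.abs_lt (half_pos hδ)).inter (hW.abs_lt (half_pos hδ))).mono
    (Eventually.of_forall fun n ω hω => ?_)
  have h1 := hω.1
  have h2 := hω.2
  simp only [Set.mem_ofPred_eq] at h1 h2 ⊢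
  exact (abs_add_le _ _).trans_lt (by linarith)

theorem IsLittleOPOne.mul_isBigOPOne (hZ : IsLittleOPOne μ Z) (hW : IsBigOPOne μ W) :
    IsLittleOPOne μ fun n ω => Z n ω * W n ω := by
  intro δ hδ
  rw [ENNReal.tendsto_atTop_zero]
  intro η hη
  have hη2 : 0 < η / 2 := ENNReal.half_pos hη.ne'
  obtain ⟨M, hM, hWM⟩ := hW (η / 2) hη2
  have hZM := (ENNReal.tendsto_nhds_zero.1 (hZ (δ / M) (div_pos hδ hM))) (η / 2) hη2
  obtain ⟨N, hN⟩ := eventually_atTop.1 (hWM.and hZM)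
  refine ⟨N, fun n hn => ?_⟩
  obtain ⟨h1, h2⟩ := hN n hn
  calc μ n {ω | δ ≤ |Z n ω * W n ω|}
      ≤ μ n ({ω | M ≤ |W n ω|} ∪ {ω | δ / M ≤ |Z n ω|}) := by
        refine measure_mono fun ω hω => ?_
        by_contra hc
        simp only [Set.mem_union, Set.mem_ofPred_eq, not_or, not_le] at hc hω
        rw [abs_mul] at hω
        have : |Z n ω| * |W n ω| < δ / M * M :=
          mul_lt_mul'' hc.2 hc.1 (abs_nonneg _) (abs_nonneg _)
        rw [div_mul_cancel₀ _ hM.ne'] at this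
        linarith
    _ ≤ η / 2 + η / 2 := (measure_union_le _ _).trans (add_le_add h1 h2)
    _ = η := ENNReal.add_halves η

theorem isBigOPOne_const (C : ℝ) : IsBigOPOne μ fun _ _ => C := by
  intro η _
  refine ⟨|C| + 1, by positivity, Eventually.of_forall fun n => ?_⟩
  have h : ¬ |C| + 1 ≤ |C| := by linarith
  simp only [h]
  simp

theorem IsLittleOPOne.mul_const (hZ : IsLittleOPOne μ Z) (C : ℝ) :
    IsLittleOPOne μ fun n ω => Z n ω * C :=
  hZ.mul_isBigOPOne (isBigOPOne_const C)

theorem IsLittleOPOne.isBigOPOne (hZ : IsLittleOPOne μ Z) : IsBigOPOne μ Z := fun η hη =>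
  ⟨1, one_pos, (ENNReal.tendsto_nhds_zero.1 (hZ 1 one_pos)) η hη⟩

theorem IsLittleOPOne.mul (hZ : IsLittleOPOne μ Z) (hW : IsLittleOPOne μ W) :
    IsLittleOPOne μ fun n ω => Z n ω * W n ω :=
  hZ.mul_isBigOPOne hW.isBigOPOne

theorem IsLittleOPOne.abs (hZ : IsLittleOPOne μ Z) : IsLittleOPOne μ fun n ω => |Z n ω| := by
  simpa [IsLittleOPOne] using hZ

theorem isLittleOPOne_zero : IsLittleOPOne μ fun _ _ => 0 := by
  intro δ hδ
  simp [hδ.not_ge]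

theorem IsLittleOPOne.finset_sum {ι : Type*} (s : Finset ι) {Z : ι → ∀ n, Ω n → ℝ}
    (hZ : ∀ i ∈ s, IsLittleOPOne μ (Z i)) : IsLittleOPOne μ fun n ω => ∑ i ∈ s, Z i n ω := by
  classical
  induction s using Finset.induction_on with
  | empty => simpa using isLittleOPOne_zero
  | insert a s ha ih =>
    simp only [Finset.sum_insert ha]
    exact (hZ a (Finset.mem_insert_self _ _)).add
      (ih fun i hi => hZ i (Finset.mem_insert_of_mem hi))

theorem IsBigOPOne.add (hZ : IsBigOPOne μ Z) (hW : IsBigOPOne μ W) :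
    IsBigOPOne μ fun n ω => Z n ω + W n ω := by
  intro η hη
  have hη2 : 0 < η / 2 := ENNReal.half_pos hη.ne'
  obtain ⟨M, hM, hZM⟩ := hZ (η / 2) hη2
  obtain ⟨M', hM', hWM⟩ := hW (η / 2) hη2
  refine ⟨M + M', by positivity, ?_⟩
  filter_upwards [hZM, hWM] with n h1 h2
  calc μ n {ω | M + M' ≤ |Z n ω + W n ω|}
      ≤ μ n ({ω | M ≤ |Z n ω|} ∪ {ω | M' ≤ |W n ω|}) := by
        refine measure_mono fun ω hω => ?_
        by_contra hc
        simp only [Set.mem_union, Set.mem_ofPred_eq, not_or, not_le] at hc hω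
        linarith [abs_add_le (Z n ω) (W n ω)]
    _ ≤ η / 2 + η / 2 := (measure_union_le _ _).trans (add_le_add h1 h2)
    _ = η := ENNReal.add_halves η

theorem IsBigOPOne.finset_sum {ι : Type*} (s : Finset ι) {Z : ι → ∀ n, Ω n → ℝ}
    (hZ : ∀ i ∈ s, IsBigOPOne μ (Z i)) : IsBigOPOne μ fun n ω => ∑ i ∈ s, Z i n ω := by
  classical
  induction s using Finset.induction_on with
  | empty => simpa using isBigOPOne_const 0
  | insert a s ha ih =>
    simp only [Finset.sum_insert ha]
    exact (hZ a (Finset.mem_insert_self _ _)).add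
      (ih fun i hi => hZ i (Finset.mem_insert_of_mem hi))

theorem IsBigOPOne.of_le (hW : IsBigOPOne μ W) (h : ∀ n ω, |Z n ω| ≤ |W n ω|) :
    IsBigOPOne μ Z := by
  intro η hη
  obtain ⟨M, hM, hWM⟩ := hW η hη
  refine ⟨M, hM, hWM.mono fun n hn => (measure_mono fun ω hω => ?_).trans hn⟩
  exact le_trans hω (h n ω)

theorem IsBigOPOne.mul_const (hZ : IsBigOPOne μ Z) (C : ℝ) :
    IsBigOPOne μ fun n ω => Z n ω * C := by
  intro η hη
  obtain ⟨M, hM, hZM⟩ := hZ η hη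
  refine ⟨M * (|C| + 1), by positivity, hZM.mono fun n hn =>
    (measure_mono fun ω hω => ?_).trans hn⟩
  simp only [Set.mem_ofPred_eq, abs_mul] at hω ⊢
  have h1 : |Z n ω| * |C| ≤ |Z n ω| * (|C| + 1) := by gcongr; linarith
  exact le_of_mul_le_mul_right (hω.trans h1) (by positivity)

theorem IsBigOPOne.abs (hZ : IsBigOPOne μ Z) : IsBigOPOne μ fun n ω => |Z n ω| :=
  hZ.of_le fun n ω => by simp

end StochasticOrders

/-! ### Deterministic analysis of the square-root lasso -/

section Deterministic

variable {n K : ℕ}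

theorem l1Norm_nonneg (v : EuclideanSpace ℝ (Fin n)) : 0 ≤ l1Norm v :=
  Finset.sum_nonneg fun _ _ => abs_nonneg _

theorem abs_apply_le_vecSupNorm (v : EuclideanSpace ℝ (Fin n)) (i : Fin n) :
    |v i| ≤ vecSupNorm v :=
  norm_le_pi_norm (fun i => v i : Fin n → ℝ) i

theorem vecSupNorm_nonneg (v : EuclideanSpace ℝ (Fin n)) : 0 ≤ vecSupNorm v := norm_nonneg _

theorem matSupNorm_nonneg {m k : ℕ} (M : Matrix (Fin m) (Fin k) ℝ) : 0 ≤ matSupNorm M :=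
  norm_nonneg _

theorem abs_apply_le_matSupNorm {m k : ℕ} (M : Matrix (Fin m) (Fin k) ℝ) (i : Fin m)
    (j : Fin k) : |M i j| ≤ matSupNorm M :=
  (norm_le_pi_norm (fun j => M i j : Fin k → ℝ) j).trans
    (norm_le_pi_norm (fun i j => M i j : Fin m → Fin k → ℝ) i)

theorem matSupNorm_le_sum {m k : ℕ} (M : Matrix (Fin m) (Fin k) ℝ) :
    matSupNorm M ≤ ∑ i, ∑ j, |M i j| := by
  have hnn : ∀ i, 0 ≤ ∑ j, |M i j| := fun i => Finset.sum_nonneg fun _ _ => abs_nonneg _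
  refine (pi_norm_le_iff_of_nonneg (Finset.sum_nonneg fun i _ => hnn i)).2 fun i => ?_
  refine (pi_norm_le_iff_of_nonneg (Finset.sum_nonneg fun i _ => hnn i)).2 fun j => ?_
  calc ‖M i j‖ = |M i j| := rfl
    _ ≤ ∑ j, |M i j| := Finset.single_le_sum (f := fun j => |M i j|)
        (fun _ _ => abs_nonneg _) (Finset.mem_univ j)
    _ ≤ _ := Finset.single_le_sum (f := fun i => ∑ j, |M i j|)
        (fun i _ => hnn i) (Finset.mem_univ i)

theorem abs_inner_le_vecSupNorm_mul_l1Norm (u h : EuclideanSpace ℝ (Fin n)) :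
    |inner ℝ u h| ≤ vecSupNorm u * l1Norm h := by
  simp only [PiLp.inner_apply, l1Norm, Finset.mul_sum]
  refine (Finset.abs_sum_le_sum_abs _ _).trans (Finset.sum_le_sum fun i _ => ?_)
  rw [show inner ℝ (u i) (h i) = u i * h i by simp [mul_comm], abs_mul]
  exact mul_le_mul_of_nonneg_right (abs_apply_le_vecSupNorm u i) (abs_nonneg _)

/-- Cauchy–Schwarz on `J`. With `J` the support of `α` it produces the factor `√s` of the oracle
inequality. -/
theorem sum_abs_le_sqrt_card_mul_norm (J : Finset (Fin n)) (h : EuclideanSpace ℝ (Fin n)) :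
    ∑ i ∈ J, |h i| ≤ √(J.card : ℝ) * ‖h‖ := by
  have h1 : (∑ i ∈ J, |h i|) ^ 2 ≤ J.card * ∑ i ∈ J, |h i| ^ 2 := sq_sum_le_card_mul_sum_sq
  have h2 : ∑ i ∈ J, |h i| ^ 2 ≤ ‖h‖ ^ 2 := by
    rw [EuclideanSpace.real_norm_sq_eq]
    simp only [sq_abs]
    exact Finset.sum_le_sum_of_subset_of_nonneg (Finset.subset_univ _)
      fun _ _ _ => sq_nonneg _
  refine abs_le_of_sq_le_sq' ?_ (by positivity) |>.2
  rw [mul_pow, Real.sq_sqrt (by positivity)]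
  exact h1.trans (mul_le_mul_of_nonneg_left h2 (by positivity))

theorem norm_le_sqrt_mul_vecSupNorm (u : EuclideanSpace ℝ (Fin n)) :
    ‖u‖ ≤ √(n : ℝ) * vecSupNorm u := by
  refine abs_le_of_sq_le_sq' ?_ (mul_nonneg (by positivity) (vecSupNorm_nonneg u)) |>.2
  rw [mul_pow, Real.sq_sqrt (by positivity), EuclideanSpace.real_norm_sq_eq]
  calc ∑ i, u i ^ 2 ≤ ∑ _i : Fin n, vecSupNorm u ^ 2 := by
        refine Finset.sum_le_sum fun i _ => ?_
        rw [← sq_abs]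
        exact pow_le_pow_left₀ (abs_nonneg _) (abs_apply_le_vecSupNorm u i) 2
    _ = _ := by simp

/-- `X b` is linear in `b`. -/
def fittedLinear (X : Matrix (Fin n) (Fin K) ℝ) :
    EuclideanSpace ℝ (Fin K) →ₗ[ℝ] EuclideanSpace ℝ (Fin n) where
  toFun := fitted X
  map_add' a b := by ext i; simp [fitted, Matrix.mulVec_add]
  map_smul' c b := by ext i; simp [fitted, Matrix.mulVec_smul]

theorem fitted_eq_sum (X : Matrix (Fin n) (Fin K) ℝ) (b : EuclideanSpace ℝ (Fin K)) :
    fitted X b = ∑ k, b k • (WithLp.toLp 2 fun i => X i k : EuclideanSpace ℝ (Fin n)) := by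
  ext i
  simp [fitted, Matrix.mulVec, dotProduct, mul_comm]

theorem fitted_mem (X : Matrix (Fin n) (Fin K) ℝ) (b : EuclideanSpace ℝ (Fin K)) :
    fitted X b ∈ columnSpan X := by
  rw [fitted_eq_sum]
  exact Submodule.sum_mem _ fun k _ => Submodule.smul_mem _ _ (Submodule.subset_span ⟨k, rfl⟩)

theorem exists_fitted_eq (X : Matrix (Fin n) (Fin K) ℝ) {v : EuclideanSpace ℝ (Fin n)}
    (hv : v ∈ columnSpan X) : ∃ b, fitted X b = v := by
  obtain ⟨c, hc⟩ := (Submodule.mem_span_range_iff_exists_fun ℝ).1 hv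
  exact ⟨WithLp.toLp 2 c, by rw [fitted_eq_sum]; exact hc⟩

theorem inner_fitted (X : Matrix (Fin n) (Fin K) ℝ) (b : EuclideanSpace ℝ (Fin K))
    (v : EuclideanSpace ℝ (Fin n)) :
    inner ℝ (fitted X b) v = inner ℝ b (fitted Xᵀ v) := by
  simp only [PiLp.inner_apply, fitted, Matrix.mulVec, dotProduct]
  simp only [RCLike.inner_apply, conj_trivial, Finset.mul_sum, Finset.sum_mul,
    Matrix.transpose_apply]
  rw [Finset.sum_comm]
  exact Finset.sum_congr rfl fun _ _ => Finset.sum_congr rfl fun _ _ => by ring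

theorem residualMaker_sub (X : Matrix (Fin n) (Fin K) ℝ) (v w : EuclideanSpace ℝ (Fin n)) :
    residualMaker X (v - w) = residualMaker X v - residualMaker X w := by
  simp only [residualMaker, map_sub]
  abel

theorem residualMaker_add (X : Matrix (Fin n) (Fin K) ℝ) (v w : EuclideanSpace ℝ (Fin n)) :
    residualMaker X (v + w) = residualMaker X v + residualMaker X w := by
  simp only [residualMaker, map_add]
  abel

theorem residualMaker_fitted (X : Matrix (Fin n) (Fin K) ℝ) (b : EuclideanSpace ℝ (Fin K)) :
    residualMaker X (fitted X b) = 0 := by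
  rw [residualMaker, Submodule.starProjection_eq_self_iff.2 (fitted_mem X b), sub_self]

theorem inner_residualMaker (X : Matrix (Fin n) (Fin K) ℝ) {v : EuclideanSpace ℝ (Fin n)}
    (hv : v ∈ columnSpan X) (w : EuclideanSpace ℝ (Fin n)) :
    inner ℝ v (residualMaker X w) = 0 :=
  (columnSpan X).sub_starProjection_mem_orthogonal w v hv

theorem norm_sq_residualMaker (X : Matrix (Fin n) (Fin K) ℝ) (v : EuclideanSpace ℝ (Fin n)) :
    ‖residualMaker X v‖ ^ 2 = ‖v‖ ^ 2 - ‖(columnSpan X).starProjection v‖ ^ 2 := by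
  have h : v = residualMaker X v + (columnSpan X).starProjection v := by simp [residualMaker]
  have h0 := inner_residualMaker X ((columnSpan X).starProjection_apply_mem v) v
  have h2 : ‖v‖ ^ 2 = ‖residualMaker X v‖ ^ 2 + ‖(columnSpan X).starProjection v‖ ^ 2 := by
    conv_lhs => rw [h]
    rw [norm_add_sq_real, real_inner_comm, h0]
    ring
  linarith

/-- At the square-root lasso, the residual is the projection of `y - a` off the columns. -/
theorem IsSqrtLasso.residual_eq {lam : ℝ} {X : Matrix (Fin n) (Fin K) ℝ}
    {y a : EuclideanSpace ℝ (Fin n)} {b : EuclideanSpace ℝ (Fin K)} (hn : 0 < n)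
    (h : IsSqrtLasso lam X y b a) : y - fitted X b - a = residualMaker X (y - a) := by
  -- `b'` is a least squares slope for `y - a`. With `a` held fixed the penalties cancel, and
  -- Pythagoras forces `X (b' - b) = 0`; `X` need not have full rank.
  obtain ⟨b', hb'⟩ := exists_fitted_eq X ((columnSpan X).starProjection_apply_mem (y - a))
  have h1 := h b' a
  simp only [sqrtLassoObjective, add_le_add_iff_right] at h1
  have hs : (0 : ℝ) < 1 / √(n : ℝ) := by positivity
  replace h1 := le_of_mul_le_mul_left h1 hs
  have e1 : y - fitted X b' - a = residualMaker X (y - a) := by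
    rw [residualMaker, hb']; abel
  have e2 : y - fitted X b - a = residualMaker X (y - a) + fitted X (b' - b) := by
    have : fitted X (b' - b) = fitted X b' - fitted X b := (fittedLinear X).map_sub b' b
    rw [this, ← e1]; abel
  rw [e1, e2] at h1
  have h2 := norm_add_sq_real (residualMaker X (y - a)) (fitted X (b' - b))
  rw [real_inner_comm, inner_residualMaker X (fitted_mem X _)] at h2
  have h3 : ‖residualMaker X (y - a) + fitted X (b' - b)‖ ^ 2 ≤ ‖residualMaker X (y - a)‖ ^ 2 :=
    pow_le_pow_left₀ (norm_nonneg _) h1 2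
  have h4 : ‖fitted X (b' - b)‖ = 0 := by
    have : ‖fitted X (b' - b)‖ ^ 2 ≤ 0 := by linarith
    exact pow_eq_zero_iff (two_ne_zero) |>.1 (le_antisymm this (sq_nonneg _))
  rw [e2, norm_eq_zero.1 h4, add_zero]

/-- If `P_X v = X b`, then `‖P_X v‖² = ⟨b, Xᵀ v⟩ ≤ ‖b‖ ‖Xᵀ v‖`, and `c ‖b‖ ≤ ‖P_X v‖`; one factor
`‖P_X v‖` cancels. -/
theorem norm_starProjection_le {X : Matrix (Fin n) (Fin K) ℝ} {c : ℝ} (hc : 0 < c)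
    (hX : ∀ b, c * ‖b‖ ≤ ‖fitted X b‖) (v : EuclideanSpace ℝ (Fin n)) :
    c * ‖(columnSpan X).starProjection v‖ ≤ ‖fitted Xᵀ v‖ := by
  obtain ⟨b, hb⟩ := exists_fitted_eq X ((columnSpan X).starProjection_apply_mem v)
  set P := (columnSpan X).starProjection v with hP
  have h0 := inner_residualMaker X ((columnSpan X).starProjection_apply_mem v) v
  have h1 : ‖P‖ ^ 2 = inner ℝ b (fitted Xᵀ v) := by
    rw [← inner_fitted, hb]
    rw [residualMaker, inner_sub_right, ← hP, real_inner_self_eq_norm_sq] at h0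
    linarith
  have h2 : ‖P‖ ^ 2 ≤ ‖b‖ * ‖fitted Xᵀ v‖ := h1 ▸ real_inner_le_norm _ _
  have h3 := hX b
  rw [hb] at h3
  rcases (norm_nonneg P).eq_or_lt with h | h
  · rw [← h]; simp
  · have h4 : c * ‖P‖ ^ 2 ≤ ‖P‖ * ‖fitted Xᵀ v‖ := by
      calc c * ‖P‖ ^ 2 ≤ c * (‖b‖ * ‖fitted Xᵀ v‖) := mul_le_mul_of_nonneg_left h2 hc.le
        _ = (c * ‖b‖) * ‖fitted Xᵀ v‖ := by ring
        _ ≤ _ := mul_le_mul_of_nonneg_right h3 (norm_nonneg _)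
    refine le_of_mul_le_mul_left ?_ h
    linarith

/-- Hölder in each of the `K` coordinates. It serves twice: to show that `P_X` barely sees a vector
in the cone, and to turn the `ℓ₁` rate into a bound on the bias of the score. -/
theorem norm_fitted_transpose_le (X : Matrix (Fin n) (Fin K) ℝ)
    (v : EuclideanSpace ℝ (Fin n)) :
    ‖fitted Xᵀ v‖ ≤ √(K : ℝ) * (matSupNorm X * l1Norm v) := by
  have hm := mul_nonneg (matSupNorm_nonneg X) (l1Norm_nonneg v)
  refine (norm_le_sqrt_mul_vecSupNorm _).trans
    (mul_le_mul_of_nonneg_left ?_ (Real.sqrt_nonneg _))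
  refine (pi_norm_le_iff_of_nonneg hm).2 fun k => ?_
  simp only [fitted, Matrix.mulVec, dotProduct, Matrix.transpose_apply, Real.norm_eq_abs]
  refine (Finset.abs_sum_le_sum_abs _ _).trans ?_
  rw [l1Norm, Finset.mul_sum]
  refine Finset.sum_le_sum fun i _ => ?_
  rw [abs_mul]
  exact mul_le_mul_of_nonneg_right (abs_apply_le_matSupNorm X i k) (abs_nonneg _)

/-- The number of nonzero coordinates. -/
def numNonzero (v : EuclideanSpace ℝ (Fin n)) : ℕ := (Finset.univ.filter fun i => v i ≠ 0).card

/-- On the support of `α` the triangle inequality loses at most `|h i|`; off the support `α`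
vanishes, so all of `|h i|` is gained. -/
theorem l1Norm_sub_l1Norm_add_le (α h : EuclideanSpace ℝ (Fin n)) :
    l1Norm α - l1Norm (α + h) ≤
      2 * ∑ i ∈ Finset.univ.filter (fun i => α i ≠ 0), |h i| - l1Norm h := by
  classical
  have key : ∀ v : EuclideanSpace ℝ (Fin n), l1Norm v =
      ∑ i ∈ Finset.univ.filter (fun i => α i ≠ 0), |v i| +
        ∑ i ∈ Finset.univ.filter (fun i => ¬ α i ≠ 0), |v i| := fun v =>
    (Finset.sum_filter_add_sum_filter_not _ _ _).symm
  rw [key α, key (α + h), key h]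
  have h1 : ∑ i ∈ Finset.univ.filter (fun i => ¬ α i ≠ 0), |α i| = 0 :=
    Finset.sum_eq_zero fun i hi => by
      have := (Finset.mem_filter.1 hi).2
      simp only [not_not] at this
      simp [this]
  have h2 : ∑ i ∈ Finset.univ.filter (fun i => ¬ α i ≠ 0), |(α + h) i| =
      ∑ i ∈ Finset.univ.filter (fun i => ¬ α i ≠ 0), |h i| :=
    Finset.sum_congr rfl fun i hi => by
      have := (Finset.mem_filter.1 hi).2
      simp only [not_not] at this
      simp [this]
  have h3 : ∑ i ∈ Finset.univ.filter (fun i => α i ≠ 0), |α i| ≤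
      ∑ i ∈ Finset.univ.filter (fun i => α i ≠ 0), |(α + h) i| +
        ∑ i ∈ Finset.univ.filter (fun i => α i ≠ 0), |h i| := by
    rw [← Finset.sum_add_distrib]
    refine Finset.sum_le_sum fun i _ => ?_
    have := abs_sub ((α + h) i) (h i)
    simpa using this
  linarith

theorem residualMaker_outcome_sub (X : Matrix (Fin n) (Fin K) ℝ) (β : EuclideanSpace ℝ (Fin K))
    (α ε v : EuclideanSpace ℝ (Fin n)) :
    residualMaker X (outcome X β α ε - v) = residualMaker X ε - residualMaker X (v - α) := by
  rw [outcome, residualMaker_sub, residualMaker_add, residualMaker_add, residualMaker_fitted,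
    residualMaker_sub]
  abel

/-- The basic inequality of the lasso. The competitor is the true `α` paired with a least squares
slope for `y - α`, whose residual is exactly `M_X ε`. -/
theorem IsSqrtLasso.norm_residual_le {lam : ℝ} {X : Matrix (Fin n) (Fin K) ℝ}
    {β b : EuclideanSpace ℝ (Fin K)} {α ε a : EuclideanSpace ℝ (Fin n)} (hn : 0 < n)
    (h : IsSqrtLasso lam X (outcome X β α ε) b a) :
    ‖residualMaker X ε - residualMaker X (a - α)‖ ≤
      ‖residualMaker X ε‖ + lam / √(n : ℝ) * (l1Norm α - l1Norm a) := by
  obtain ⟨b', hb'⟩ := exists_fitted_eq X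
    ((columnSpan X).starProjection_apply_mem (outcome X β α ε - α))
  have h1 := h b' α
  have e0 := residualMaker_outcome_sub X β α ε
  have e1 : outcome X β α ε - fitted X b' - α = residualMaker X ε := by
    have := e0 α
    rw [sub_self, show residualMaker X 0 = 0 by simp [residualMaker], sub_zero] at this
    rw [← this, residualMaker, hb']; abel
  rw [sqrtLassoObjective, sqrtLassoObjective, h.residual_eq hn, e0, e1] at h1
  have hs : (0 : ℝ) < √(n : ℝ) := by positivity
  have hnn : (n : ℝ) = √(n : ℝ) * √(n : ℝ) := (Real.mul_self_sqrt (by positivity)).symm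
  have h2 := mul_le_mul_of_nonneg_left h1 hs.le
  have e3 : ∀ A B : ℝ, √(n : ℝ) * (1 / √(n : ℝ) * A + lam / n * B) = A + lam / √(n : ℝ) * B := by
    intro A B
    rw [show lam / (n : ℝ) = lam / (√(n : ℝ) * √(n : ℝ)) by rw [← hnn]]
    field_simp
  rw [e3, e3] at h2
  linarith

/-- Once `u²` cancels, `g² ≤ 12 τ u g + 4 τ² g²`. Since `τ² ≤ 1/16`, the last term is at most `g² /
4`, and `12 / (3/4) = 16`. -/
theorem le_of_perturbed_quadratic {u g p τ : ℝ} (hu : 0 ≤ u) (hg : 0 ≤ g) (hτ0 : 0 ≤ τ)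
    (hτ : τ ≤ 1 / 4) (hp : 2 * p ≤ 8 * τ * u * g)
    (h : u ^ 2 - 2 * p + g ^ 2 ≤ (u + 2 * τ * g) ^ 2) : g ≤ 16 * τ * u := by
  rcases hg.eq_or_lt with h0 | h0
  · rw [← h0]; positivity
  · have hτ2 : τ ^ 2 ≤ 1 / 16 := by nlinarith
    have h9 : g * g ≤ g * (16 * τ * u) := by
      nlinarith [mul_le_mul_of_nonneg_right hτ2 (sq_nonneg g)]
    exact le_of_mul_le_mul_left h9 h0

/-- Oracle inequalities for the square-root lasso with the identity design for the penalized
coefficients. -/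
theorem IsSqrtLasso.oracle {lam : ℝ} {X : Matrix (Fin n) (Fin K) ℝ}
    {β b : EuclideanSpace ℝ (Fin K)} {α ε a : EuclideanSpace ℝ (Fin n)} (hn : 0 < n)
    (h : IsSqrtLasso lam X (outcome X β α ε) b a) (hlam : 0 < lam)
    (hu : residualMaker X ε ≠ 0)
    (hpen : 2 * √(n : ℝ) * (vecSupNorm (residualMaker X ε) / ‖residualMaker X ε‖) ≤ lam)
    {c : ℝ} (hc : 0 < c) (hX : ∀ b, c * ‖b‖ ≤ ‖fitted X b‖)
    (hsmall : 8 * (√(K : ℝ) * matSupNorm X * √(numNonzero α : ℝ)) ≤ c)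
    (htau : lam * √(numNonzero α : ℝ) / √(n : ℝ) ≤ 1 / 4) :
    ‖residualMaker X (a - α)‖ ≤
        16 * (lam * √(numNonzero α : ℝ) / √(n : ℝ)) * ‖residualMaker X ε‖ ∧
      l1Norm (a - α) ≤ 128 * (lam * numNonzero α / √(n : ℝ)) * ‖residualMaker X ε‖ := by
  have hb := h.norm_residual_le hn
  set u := residualMaker X ε with hu_def
  set d := a - α with hd
  set g := residualMaker X d with hg
  set s : ℝ := √(numNonzero α : ℝ) with hs_def
  have hs0 : 0 ≤ s := Real.sqrt_nonneg _
  have hss : s * s = numNonzero α := Real.mul_self_sqrt (by positivity)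
  have hr : (0 : ℝ) < √(n : ℝ) := by positivity
  set r : ℝ := √(n : ℝ) with hr_def
  have hup : 0 < ‖u‖ := norm_pos_iff.2 hu
  set L := l1Norm d with hL
  have hL0 : 0 ≤ L := l1Norm_nonneg d
  set H := ∑ i ∈ Finset.univ.filter (fun i => α i ≠ 0), |d i| with hH
  have hl1 : l1Norm α - l1Norm a ≤ 2 * H - L := by
    have := l1Norm_sub_l1Norm_add_le α d
    rwa [show α + d = a by rw [hd]; abel] at this
  have hHs : H ≤ s * ‖d‖ := sum_abs_le_sqrt_card_mul_norm _ d
  have hlr : 0 < lam / r := div_pos hlam hr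
  have hb2 : ‖u - g‖ ≤ ‖u‖ + lam / r * (2 * H - L) :=
    hb.trans (by linarith [mul_le_mul_of_nonneg_left hl1 hlr.le])
  -- `u` is orthogonal to the columns of `X`, so the projection in `g` is invisible to it, and the
  -- sup norm of `u` can be paired with the `ℓ₁` norm of `d`.
  have hug : inner ℝ u g = inner ℝ u d := by
    have : inner ℝ u ((columnSpan X).starProjection d) = 0 := by
      rw [real_inner_comm]
      exact inner_residualMaker X ((columnSpan X).starProjection_apply_mem d) ε
    rw [hg, residualMaker, inner_sub_right, this, sub_zero]
  have hpen2 : 2 * vecSupNorm u ≤ lam / r * ‖u‖ := by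
    rw [div_mul_eq_mul_div, le_div_iff₀ hr]
    have := mul_le_mul_of_nonneg_right hpen hup.le
    rw [show 2 * r * (vecSupNorm u / ‖u‖) * ‖u‖ = 2 * vecSupNorm u * r by field_simp] at this
    exact this
  have hinner : 2 * |inner ℝ u g| ≤ lam / r * ‖u‖ * L := by
    rw [hug]
    calc 2 * |inner ℝ u d| ≤ 2 * (vecSupNorm u * L) := by
          linarith [abs_inner_le_vecSupNorm_mul_l1Norm u d]
      _ = (2 * vecSupNorm u) * L := by ring
      _ ≤ _ := mul_le_mul_of_nonneg_right hpen2 hL0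
  have hcs : ‖u‖ ^ 2 - inner ℝ u g ≤ ‖u‖ * ‖u - g‖ := by
    have := real_inner_le_norm u (u - g)
    rwa [inner_sub_right, real_inner_self_eq_norm_sq] at this
  -- `hcs`, `hb2` and `hinner` combine to `-L / 2 ≤ 2 H - L` after division by `(lam / r) ‖u‖`. The
  -- factor 2 in the penalty condition is what leaves half of `L`.
  have hcone : L ≤ 4 * H := by
    have h1 : ‖u‖ * ‖u - g‖ ≤ ‖u‖ * (‖u‖ + lam / r * (2 * H - L)) :=
      mul_le_mul_of_nonneg_left hb2 hup.le
    have h2 := le_abs_self (inner ℝ u g)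
    have h3 : 0 ≤ (lam / r * ‖u‖) * (4 * H - L) := by linarith
    have := (mul_nonneg_iff_of_pos_left (mul_pos hlr hup)).1 h3
    linarith
  have hLd : L ≤ 4 * s * ‖d‖ := by linarith
  -- The substitute for a restricted eigenvalue condition: the 8 in `hsmall` is the cone constant 4
  -- times the 2 that leaves half of `‖d‖`.
  have hPd : ‖(columnSpan X).starProjection d‖ ≤ ‖d‖ / 2 := by
    have h1 := (norm_starProjection_le hc hX d).trans (norm_fitted_transpose_le X d)
    have h2 : √(K : ℝ) * (matSupNorm X * L) ≤ c * (‖d‖ / 2) := by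
      have h3 := mul_le_mul_of_nonneg_left hLd
        (mul_nonneg (Real.sqrt_nonneg (K : ℝ)) (matSupNorm_nonneg X))
      have h4 := mul_le_mul_of_nonneg_right hsmall (norm_nonneg d)
      linarith
    exact le_of_mul_le_mul_left (h1.trans h2) hc
  have hdg : ‖d‖ ≤ 2 * ‖g‖ := by
    have : ‖d‖ ≤ ‖g‖ + ‖(columnSpan X).starProjection d‖ := by
      have e : d = g + (columnSpan X).starProjection d := by simp [hg, residualMaker]
      conv_lhs => rw [e]
      exact norm_add_le _ _
    linarith
  have hLg : L ≤ 8 * s * ‖g‖ := by linarith [mul_le_mul_of_nonneg_left hdg hs0]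
  have hHg : H ≤ 2 * s * ‖g‖ := by linarith [mul_le_mul_of_nonneg_left hdg hs0]
  set τ := lam * s / r with hτ
  have hτ0 : 0 ≤ τ := by positivity
  have hτ' : τ = lam / r * s := by rw [hτ]; ring
  have hb3 : ‖u - g‖ ≤ ‖u‖ + 2 * τ * ‖g‖ := by
    refine hb2.trans ?_
    -- `H` is a partial sum of `L`, so the gain in penalty is at most `H ≤ 2 s ‖g‖`, which is where
    -- the term `2 τ ‖g‖` comes from.
    have h5 : 2 * H - L ≤ H := by
      have : H ≤ L := Finset.sum_le_sum_of_subset_of_nonneg (Finset.subset_univ _)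
        fun _ _ _ => abs_nonneg _
      linarith
    have h6 := mul_le_mul_of_nonneg_left (h5.trans hHg) hlr.le
    rw [hτ']
    linarith
  have hin2 : 2 * inner ℝ u g ≤ 8 * τ * ‖u‖ * ‖g‖ := by
    have h7 := mul_le_mul_of_nonneg_left hLg (mul_pos hlr hup).le
    have h8 := le_abs_self (inner ℝ u g)
    rw [hτ']
    linarith
  have hsq : ‖u - g‖ ^ 2 ≤ (‖u‖ + 2 * τ * ‖g‖) ^ 2 := pow_le_pow_left₀ (norm_nonneg _) hb3 2
  rw [norm_sub_sq_real] at hsq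
  have hfin : ‖g‖ ≤ 16 * τ * ‖u‖ :=
    le_of_perturbed_quadratic hup.le (norm_nonneg g) hτ0 htau hin2 hsq
  refine ⟨hfin, hLg.trans ?_⟩
  calc 8 * s * ‖g‖ ≤ 8 * s * (16 * τ * ‖u‖) :=
        mul_le_mul_of_nonneg_left hfin (by positivity)
    _ = 128 * (lam * (s * s) / r) * ‖u‖ := by rw [hτ]; ring
    _ = _ := by rw [hss]

/-- The normal equations satisfied by the slope of the square-root lasso. -/
theorem IsSqrtLasso.normal_equations {lam : ℝ} {X : Matrix (Fin n) (Fin K) ℝ}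
    {β b : EuclideanSpace ℝ (Fin K)} {α ε a : EuclideanSpace ℝ (Fin n)} (hn : 0 < n)
    (h : IsSqrtLasso lam X (outcome X β α ε) b a) :
    fitted Xᵀ (fitted X (b - β)) = fitted Xᵀ ε - fitted Xᵀ (a - α) := by
  have h1 := h.residual_eq hn
  have h2 : fitted Xᵀ (outcome X β α ε - fitted X b - a) = 0 := by
    refine ext_inner_left ℝ fun v => ?_
    rw [h1, ← inner_fitted, inner_residualMaker X (fitted_mem X v), inner_zero_right]
  have e : outcome X β α ε - fitted X b - a = ε - (a - α) - fitted X (b - β) := by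
    have : fitted X (b - β) = fitted X b - fitted X β := (fittedLinear X).map_sub b β
    rw [this, outcome]; abel
  rw [e] at h2
  have hsub : ∀ v w, fitted Xᵀ (v - w) = fitted Xᵀ v - fitted Xᵀ w := (fittedLinear Xᵀ).map_sub
  rw [hsub, hsub, sub_eq_zero] at h2
  exact h2.symm

end Deterministic

/-! ### Limit theorems for triangular arrays with a common law -/

section Slutsky

/-- Factor out a phase of modulus one and use `|e^{iθ} - 1| ≤ |θ|`: the Lipschitz bound behind
Slutsky's theorem on characteristic functions. -/
theorem norm_exp_inner_sub_exp_inner_le {E : Type*} [NormedAddCommGroup E]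
    [InnerProductSpace ℝ E] (v w t : E) :
    ‖Complex.exp ((inner ℝ v t : ℝ) * Complex.I) - Complex.exp ((inner ℝ w t : ℝ) * Complex.I)‖ ≤
      ‖v - w‖ * ‖t‖ := by
  have h : Complex.exp ((inner ℝ v t : ℝ) * Complex.I) -
      Complex.exp ((inner ℝ w t : ℝ) * Complex.I) =
      Complex.exp ((inner ℝ w t : ℝ) * Complex.I) *
        (Complex.exp (Complex.I * (inner ℝ (v - w) t : ℝ)) - 1) := by
    rw [mul_sub, ← Complex.exp_add, mul_one, inner_sub_left]
    congr 2
    push_cast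
    ring
  rw [h, norm_mul, Complex.norm_exp_ofReal_mul_I, one_mul]
  refine Real.norm_exp_I_mul_ofReal_sub_one_le.trans ?_
  exact norm_inner_le_norm _ _

variable {Ω : ℕ → Type*} [∀ n, MeasurableSpace (Ω n)] {μ : ∀ n, Measure (Ω n)}
  [∀ n, IsProbabilityMeasure (μ n)] {Ω' : Type*} [MeasurableSpace Ω'] {P : Measure Ω'}
  [IsProbabilityMeasure P] {E : Type*} [NormedAddCommGroup E] [InnerProductSpace ℝ E]
  [FiniteDimensional ℝ E] [MeasurableSpace E] [BorelSpace E]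

/-- **Slutsky's theorem** along a sequence of probability spaces. -/
theorem tendstoInDistribution_of_isLittleOPOne_norm_sub {X Y : ∀ n, Ω n → E} {Z : Ω' → E}
    (hX : TendstoInDistribution X atTop Z μ P) (hY : ∀ n, AEMeasurable (Y n) (μ n))
    (h : IsLittleOPOne μ fun n ω => ‖Y n ω - X n ω‖) : TendstoInDistribution Y atTop Z μ P where
  forall_aemeasurable := hY
  aemeasurable_limit := hX.aemeasurable_limit
  tendsto := by
    have hXm := hX.forall_aemeasurable
    have hXc := ProbabilityMeasure.tendsto_iff_tendsto_charFun.1 hX.tendsto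
    refine ProbabilityMeasure.tendsto_iff_tendsto_charFun.2 fun t => ?_
    have hmeas : Measurable fun v : E => Complex.exp ((inner ℝ v t : ℝ) * Complex.I) := by
      fun_prop
    have hint : ∀ n (W : Ω n → E), AEMeasurable W (μ n) →
        Integrable (fun ω => Complex.exp ((inner ℝ (W ω) t : ℝ) * Complex.I)) (μ n) := by
      intro n W hW
      refine Integrable.of_bound (hmeas.comp_aemeasurable hW).aestronglyMeasurable 1
        (ae_of_all _ fun ω => ?_)
      rw [Complex.norm_exp_ofReal_mul_I]
    have hchar : ∀ n (W : Ω n → E), AEMeasurable W (μ n) → charFun ((μ n).map W) t =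
        ∫ ω, Complex.exp ((inner ℝ (W ω) t : ℝ) * Complex.I) ∂(μ n) := by
      intro n W hW
      rw [charFun_apply, integral_map hW hmeas.aestronglyMeasurable]
    have hdiff : Tendsto (fun n => charFun ((μ n).map (Y n)) t - charFun ((μ n).map (X n)) t)
        atTop (𝓝 0) := by
      rw [Metric.tendsto_nhds]
      intro η hη
      -- Off `A` the characters differ by at most `η / 4`; on `A` they differ by at most 2, with
      -- `P(A) < η / 8`. The `+ 1` covers `t = 0`.
      set δ := η / 4 / (‖t‖ + 1) with hδ_def
      have hδ : 0 < δ := by positivity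
      have hsmall := (ENNReal.tendsto_toReal ENNReal.zero_ne_top).comp (h δ hδ)
      simp only [ENNReal.toReal_zero, abs_norm] at hsmall
      filter_upwards [hsmall.eventually (gt_mem_nhds (show (0 : ℝ) < η / 8 by positivity))]
        with n hn
      set A := {ω | δ ≤ ‖Y n ω - X n ω‖} with hA
      have hAm : NullMeasurableSet A (μ n) :=
        nullMeasurableSet_le aemeasurable_const ((hY n).sub (hXm n)).norm
      rw [dist_zero_right, hchar n _ (hY n), hchar n _ (hXm n), ← integral_sub (hint n _ (hY n))
        (hint n _ (hXm n))]
      have hb : ∀ ω, ‖Complex.exp ((inner ℝ (Y n ω) t : ℝ) * Complex.I) -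
          Complex.exp ((inner ℝ (X n ω) t : ℝ) * Complex.I)‖ ≤
          η / 4 + A.indicator (fun _ => (2 : ℝ)) ω := by
        intro ω
        by_cases hω : ω ∈ A
        · rw [Set.indicator_of_mem hω]
          refine (norm_sub_le _ _).trans ?_
          rw [Complex.norm_exp_ofReal_mul_I, Complex.norm_exp_ofReal_mul_I]
          linarith
        · rw [Set.indicator_of_notMem hω, add_zero]
          have hlt : ‖Y n ω - X n ω‖ < δ := not_le.1 hω
          refine (norm_exp_inner_sub_exp_inner_le _ _ _).trans ?_
          calc ‖Y n ω - X n ω‖ * ‖t‖ ≤ δ * (‖t‖ + 1) :=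
                mul_le_mul hlt.le (by linarith) (norm_nonneg _) hδ.le
            _ = η / 4 := by rw [hδ_def]; field_simp
      have hind : Integrable (A.indicator fun _ => (2 : ℝ)) (μ n) :=
        (integrable_const _).indicator₀ hAm
      calc ‖∫ ω, (Complex.exp ((inner ℝ (Y n ω) t : ℝ) * Complex.I) -
            Complex.exp ((inner ℝ (X n ω) t : ℝ) * Complex.I)) ∂(μ n)‖
          ≤ ∫ ω, (η / 4 + A.indicator (fun _ => (2 : ℝ)) ω) ∂(μ n) :=
            norm_integral_le_of_norm_le ((integrable_const _).add hind) (ae_of_all _ hb)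
        _ = η / 4 + (μ n).real A * 2 := by
            rw [integral_add (integrable_const _) hind, integral_indicator₀ hAm]
            simp
        _ < η := by
            have : (μ n).real A < η / 8 := hn
            linarith
    have := hdiff.add (hXc t)
    simpa using this

end Slutsky

section Arrays

variable {E : Type*} [MeasurableSpace E] {Q : Measure E}
  {Ω : ℕ → Type*} [∀ n, MeasurableSpace (Ω n)] {μ : ∀ n, Measure (Ω n)}
  {z : ∀ n, Ω n → Fin n → E}

/-- Normalized sums of centred square-integrable variables are bounded in probability. -/
theorem isBigOPOne_normalized_sum [∀ n, IsProbabilityMeasure (μ n)]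
    (hlaw : ∀ n i, HasLaw (fun ω => z n ω i) Q (μ n))
    (hindep : ∀ n, iIndepFun (fun i ω => z n ω i) (μ n)) {f : E → ℝ} (hf : Measurable f)
    (hf2 : MemLp f 2 Q) (hf0 : ∫ e, f e ∂Q = 0) :
    IsBigOPOne μ fun n ω => (√(n : ℝ))⁻¹ * ∑ i, f (z n ω i) := by
  have hL : ∀ n (i : Fin n), MemLp (fun ω => f (z n ω i)) 2 (μ n) := fun n i =>
    MemLp.comp_of_map (by rw [(hlaw n i).map_eq]; exact hf2) (hlaw n i).aemeasurable
  have hmean : ∀ n (i : Fin n), ∫ ω, f (z n ω i) ∂(μ n) = 0 := fun n i => by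
    rw [← hf0]; exact (hlaw n i).integral_comp hf.aestronglyMeasurable
  have hvar : ∀ n (i : Fin n), Var[fun ω => f (z n ω i); μ n] = Var[f; Q] := fun n i => by
    rw [← (hlaw n i).map_eq, variance_map (by exact hf.aemeasurable) (hlaw n i).aemeasurable]
    rfl
  have hV : ∀ n, Var[∑ i : Fin n, fun ω => f (z n ω i); μ n] = n * Var[f; Q] := fun n => by
    rw [IndepFun.variance_sum (fun i _ => hL n i)
      (fun i _ j _ hij => ((hindep n).indepFun hij).comp hf hf)]
    simp [hvar]
  intro η hη
  obtain ⟨M, hM, hMη⟩ : ∃ M : ℝ, 0 < M ∧ ENNReal.ofReal (Var[f; Q] / M ^ 2) ≤ η := by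
    have h1 : Tendsto (fun M : ℝ => ENNReal.ofReal (Var[f; Q] / M ^ 2)) atTop (𝓝 0) := by
      rw [← ENNReal.ofReal_zero]
      exact ENNReal.tendsto_ofReal
        (tendsto_const_nhds.div_atTop (tendsto_pow_atTop two_ne_zero))
    obtain ⟨M, h2, h3⟩ := ((ENNReal.tendsto_nhds_zero.1 h1 η hη).and
      (eventually_gt_atTop 0)).exists
    exact ⟨M, h3, h2⟩
  refine ⟨M, hM, ?_⟩
  filter_upwards [eventually_gt_atTop 0] with n hn
  have hr : (0 : ℝ) < √(n : ℝ) := by positivity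
  have hc : 0 < M * √(n : ℝ) := by positivity
  -- Chebyshev at level `M √n`: the variance of the sum is `n Var f`, so the bound `Var f / M²` does
  -- not depend on `n`.
  have hch := meas_ge_le_variance_div_sq
    (memLp_finsetSum' Finset.univ fun i (_ : i ∈ Finset.univ) => hL n i) hc
  have hm0 : ∫ ω, (∑ i : Fin n, fun ω => f (z n ω i)) ω ∂(μ n) = 0 := by
    simp only [Finset.sum_apply]
    rw [integral_finsetSum _ fun i _ => (hL n i).integrable one_le_two]
    simp [hmean]
  rw [hm0, hV, mul_pow, Real.sq_sqrt (by positivity)] at hch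
  refine le_trans (le_of_eq ?_) (hch.trans (le_trans (le_of_eq ?_) hMη))
  · congr 1
    ext ω
    simp only [Set.mem_ofPred_eq, Finset.sum_apply, sub_zero, abs_mul, abs_inv, abs_of_pos hr]
    rw [inv_mul_eq_div, le_div_iff₀ hr]
  · congr 1
    have : (0 : ℝ) < n := by positivity
    field_simp

variable [IsProbabilityMeasure Q]

theorem hasLaw_infinitePi_restrict {E : Type*} [MeasurableSpace E] (Q : Measure E) [IsProbabilityMeasure Q] (n : ℕ) :
    HasLaw (fun (ω : ℕ → E) (i : Fin n) => ω i) (Measure.pi fun _ : Fin n => Q)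
      (Measure.infinitePi fun _ : ℕ => Q) := by
  have h : iIndepFun (fun (i : ℕ) (ω : ℕ → E) => ω i) (Measure.infinitePi fun _ : ℕ => Q) :=
    iIndepFun_infinitePi (X := fun _ => id) fun _ => measurable_id
  exact iIndepFun.hasLaw_pi
    (fun i => (measurePreserving_eval_infinitePi (fun _ : ℕ => Q) (i : ℕ)).hasLaw)
    (h.precomp Fin.val_injective)

/-- A statistic of the sample of size `n` has the law of the same statistic of the first `n`
coordinates of an infinite i.i.d. sequence. Limit theorems on that one space thus reach the array,
as far as they concern laws only. -/
theorem map_sample_eq {F : Type*} [MeasurableSpace F] 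
    (hlaw : ∀ n i, HasLaw (fun ω => z n ω i) Q (μ n))
    (hindep : ∀ n, iIndepFun (fun i ω => z n ω i) (μ n)) (n : ℕ) {g : (Fin n → E) → F}
    (hg : Measurable g) :
    (μ n).map (fun ω => g (z n ω)) =
      (Measure.infinitePi fun _ : ℕ => Q).map fun ω => g fun i : Fin n => ω i := by
  have h1 : HasLaw (fun ω i => z n ω i) (Measure.pi fun _ : Fin n => Q) (μ n) :=
    (hindep n).hasLaw_pi (hlaw n)
  have h2 := hasLaw_infinitePi_restrict Q n
  have e1 := AEMeasurable.map_map_of_aemeasurable (hg.aemeasurable) h1.aemeasurable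
  have e2 := AEMeasurable.map_map_of_aemeasurable (hg.aemeasurable) h2.aemeasurable
  rw [h1.map_eq] at e1
  rw [h2.map_eq] at e2
  exact e1.symm.trans e2

/-- The weak law of large numbers. -/
theorem isLittleOPOne_average_sub (hlaw : ∀ n i, HasLaw (fun ω => z n ω i) Q (μ n))
    (hindep : ∀ n, iIndepFun (fun i ω => z n ω i) (μ n)) {f : E → ℝ} (hf : Measurable f)
    (hfi : Integrable f Q) :
    IsLittleOPOne μ fun n ω => 1 / (n : ℝ) * ∑ i, f (z n ω i) - ∫ e, f e ∂Q := by
  set P := Measure.infinitePi fun _ : ℕ => Q with hP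
  have hmp : ∀ i, MeasurePreserving (fun ω : ℕ → E => ω i) P Q := fun i =>
    measurePreserving_eval_infinitePi (fun _ : ℕ => Q) i
  have hind : iIndepFun (fun (i : ℕ) (ω : ℕ → E) => f (ω i)) P :=
    iIndepFun_infinitePi (X := fun _ => f) fun _ => hf
  have hlim := strong_law_ae_real (fun i (ω : ℕ → E) => f (ω i))
    ((hmp 0).integrable_comp_of_integrable hfi) (fun i j hij => hind.indepFun hij)
    (fun i => ⟨(hf.comp (measurable_pi_apply i)).aemeasurable,
      (hf.comp (measurable_pi_apply 0)).aemeasurable,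
      (Measure.map_map hf (hmp i).measurable).symm.trans
        (((hmp i).map_eq.trans (hmp 0).map_eq.symm ▸ rfl : (P.map fun ω => ω i).map f =
          (P.map fun ω => ω 0).map f).trans (Measure.map_map hf (hmp 0).measurable))⟩)
  have hmean : ∫ ω, f (ω 0) ∂P = ∫ e, f e ∂Q := by
    rw [← (hmp 0).map_eq, integral_map (hmp 0).measurable.aemeasurable hf.aestronglyMeasurable]
  rw [hmean] at hlim
  -- Almost sure convergence is not a statement about the law at each `n`; convergence in
  -- probability is, so the strong law is weakened before the transfer.
  have hm := tendstoInMeasure_of_tendsto_ae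
    (fun n => (show Measurable fun ω : ℕ → E => (∑ i ∈ Finset.range n, f (ω i)) / (n : ℝ) by
      fun_prop).aestronglyMeasurable) hlim
  rw [tendstoInMeasure_iff_norm] at hm
  intro δ hδ
  refine (hm δ hδ).congr fun n => ?_
  have hg : Measurable fun v : Fin n → E => 1 / (n : ℝ) * ∑ i, f (v i) - ∫ e, f e ∂Q := by
    fun_prop
  have hs : MeasurableSet {r : ℝ | δ ≤ |r|} := measurableSet_le (by fun_prop) (by fun_prop)
  have e := congrArg (fun ν => ν {r : ℝ | δ ≤ |r|}) (map_sample_eq hlaw hindep n hg)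
  have haem : AEMeasurable (fun ω => 1 / (n : ℝ) * ∑ i, f (z n ω i) - ∫ e, f e ∂Q) (μ n) :=
    hg.comp_aemeasurable (((hindep n).hasLaw_pi (hlaw n)).aemeasurable)
  simp only at e
  rw [Measure.map_apply_of_aemeasurable haem hs, Measure.map_apply (by fun_prop) hs] at e
  refine Eq.trans ?_ e.symm
  congr 1
  ext ω
  simp only [Set.mem_ofPred_eq, Set.mem_preimage, Real.norm_eq_abs, Finset.sum_range,
    one_div_mul_eq_div]

/-- The multivariate central limit theorem. -/
theorem tendstoInDistribution_normalized_sum {K : ℕ} [∀ n, IsProbabilityMeasure (μ n)]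
    (hlaw : ∀ n i, HasLaw (fun ω => z n ω i) Q (μ n))
    (hindep : ∀ n, iIndepFun (fun i ω => z n ω i) (μ n)) {f : E → EuclideanSpace ℝ (Fin K)}
    (hf : Measurable f) (hf2 : ∀ t, MemLp (fun e => (inner ℝ (f e) t : ℝ)) 2 Q)
    (hf0 : ∀ t, ∫ e, (inner ℝ (f e) t : ℝ) ∂Q = 0) {V : Matrix (Fin K) (Fin K) ℝ}
    (hV : V.PosSemidef)
    (hfV : ∀ t : EuclideanSpace ℝ (Fin K), ∫ e, (inner ℝ (f e) t : ℝ) ^ 2 ∂Q = t ⬝ᵥ V *ᵥ t) :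
    TendstoInDistribution (fun (n : ℕ) ω => (√(n : ℝ))⁻¹ • ∑ i, f (z n ω i)) atTop
      (fun v : EuclideanSpace ℝ (Fin K) => v) μ (multivariateGaussian 0 V) where
  forall_aemeasurable n := by
    have : Measurable fun v : Fin n → E => (√(n : ℝ))⁻¹ • ∑ i, f (v i) := by fun_prop
    exact this.comp_aemeasurable (((hindep n).hasLaw_pi (hlaw n)).aemeasurable)
  tendsto := by
    refine ProbabilityMeasure.tendsto_iff_tendsto_charFun.2 fun t => ?_
    set P := Measure.infinitePi fun _ : ℕ => Q with hP
    -- Cramér–Wold: the characteristic function at `t` of the vector sum is that of the projected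
    -- sum at `1`, so the real central limit theorem suffices.
    set X : ℕ → (ℕ → E) → ℝ := fun k ω => inner ℝ (f (ω k)) t with hX
    have hft : Measurable fun e => (inner ℝ (f e) t : ℝ) := by fun_prop
    have hmp : ∀ i, MeasurePreserving (fun ω : ℕ → E => ω i) P Q := fun i =>
      measurePreserving_eval_infinitePi (fun _ : ℕ => Q) i
    have hind : iIndepFun X P :=
      iIndepFun_infinitePi (X := fun _ e => (inner ℝ (f e) t : ℝ)) fun _ => hft
    have hX2 : MemLp (X 0) 2 P := (hf2 t).comp_measurePreserving (hmp 0)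
    have hXm : ∀ i, P.map (X i) = Q.map fun e => (inner ℝ (f e) t : ℝ) := fun i => by
      rw [← (hmp i).map_eq, Measure.map_map hft (by fun_prop)]
      rfl
    have hX0 : P[X 0] = 0 := by
      rw [← hf0 t, ← (hmp 0).map_eq, integral_map (hmp 0).measurable.aemeasurable hft.aestronglyMeasurable]
    have hXv : Var[X 0; P] = t ⬝ᵥ V *ᵥ t := by
      rw [← hfV t, variance_of_integral_eq_zero hX2.aemeasurable hX0, ← (hmp 0).map_eq,
        integral_map (hmp 0).measurable.aemeasurable (hft.pow_const 2).aestronglyMeasurable]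
    have hclt := tendstoInDistribution_inv_sqrt_mul_sum_sub
      (Y := id) (P' := gaussianReal 0 Var[X 0; P].toNNReal) HasLaw.id hX2 hind
      (fun i => ⟨by fun_prop, by fun_prop, (hXm i).trans (hXm 0).symm⟩)
    have hch := ProbabilityMeasure.tendsto_iff_tendsto_charFun.1 hclt.tendsto 1
    simp only [ProbabilityMeasure.coe_mk, Measure.map_id, charFun_gaussianReal, hX0] at hch
    simp only [ProbabilityMeasure.coe_mk, Measure.map_id', charFun_multivariateGaussian hV]
    have hlim : Complex.exp (((1 : ℝ) : ℂ) * ((0 : ℝ) : ℂ) * Complex.I -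
        ((Var[X 0; P].toNNReal : ℝ) : ℂ) * ((1 : ℝ) : ℂ) ^ 2 / 2) =
        Complex.exp ((inner ℝ t (0 : EuclideanSpace ℝ (Fin K)) : ℝ) * Complex.I -
          ((t ⬝ᵥ V *ᵥ t : ℝ) : ℂ) / 2) := by
      rw [Real.coe_toNNReal _ (variance_nonneg _ _), hXv]
      simp
    refine (hch.congr fun n => ?_).trans (le_of_eq (congrArg 𝓝 hlim))
    have hg : Measurable fun v : Fin n → E => (√(n : ℝ))⁻¹ • ∑ i, f (v i) := by fun_prop
    rw [map_sample_eq hlaw hindep n hg, charFun_apply, charFun_apply,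
      integral_map (by fun_prop) (by fun_prop),
      integral_map (show Measurable fun ω : ℕ → E => (√(n : ℝ))⁻¹ • ∑ i : Fin n, f (ω i) by
        fun_prop).aemeasurable (by fun_prop)]
    refine integral_congr_ae (ae_of_all _ fun ω => ?_)
    simp only [hX, inner_smul_left, sum_inner, Finset.sum_range, mul_zero, sub_zero]
    simp

end Arrays

/-! ### Moments of the regression model -/

section Moments

/-! ### Conditional homoskedasticity as an identity between first marginals -/

section Homoskedastic

variable {A : Type*} [MeasurableSpace A] {Q : Measure (A × ℝ)} [IsProbabilityMeasure Q] {σ : ℝ}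

/-- Under homoskedasticity the measure with density `ε²` has the same first marginal as
`σ² Q`. -/
theorem map_fst_withDensity_sq (hε : MemLp (fun z : A × ℝ => z.2) 2 Q)
    (hhom : Q[fun z => z.2 ^ 2 | MeasurableSpace.comap (fun z : A × ℝ => z.1) inferInstance]
      =ᵐ[Q] fun _ => σ ^ 2) :
    (Q.withDensity fun z => ENNReal.ofReal (z.2 ^ 2)).map Prod.fst =
      ENNReal.ofReal (σ ^ 2) • Q.map Prod.fst := by
  ext s hs
  have hm : MeasurableSpace.comap (fun z : A × ℝ => z.1) inferInstance ≤
      (inferInstance : MeasurableSpace (A × ℝ)) := measurable_fst.comap_le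
  have hi : Integrable (fun z : A × ℝ => z.2 ^ 2) Q := hε.integrable_sq
  have hpre : MeasurableSet (Prod.fst ⁻¹' s : Set (A × ℝ)) := measurable_fst hs
  have h1 := setIntegral_condExp hm hi (s := Prod.fst ⁻¹' s) ⟨s, hs, rfl⟩
  rw [setIntegral_congr_ae (g := fun _ => σ ^ 2) hpre (hhom.mono fun z hz _ => hz)] at h1
  rw [Measure.map_apply measurable_fst hs, withDensity_apply _ hpre,
    ← ofReal_integral_eq_lintegral_ofReal hi.restrict (ae_of_all _ fun z => sq_nonneg _), ← h1]
  simp only [Measure.smul_apply, smul_eq_mul, Measure.map_apply measurable_fst hs]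
  rw [setIntegral_const, smul_eq_mul, mul_comm, ENNReal.ofReal_mul (sq_nonneg σ),
    ofReal_measureReal]

theorem integral_sq_eq (hhom : Q[fun z => z.2 ^ 2 |
      MeasurableSpace.comap (fun z : A × ℝ => z.1) inferInstance] =ᵐ[Q] fun _ => σ ^ 2) :
    ∫ z, z.2 ^ 2 ∂Q = σ ^ 2 := by
  rw [← integral_condExp (measurable_fst (α := A) (β := ℝ)).comap_le, integral_congr_ae hhom]
  simp

/-- Integrate `φ²` against both sides of the identity of first marginals. Working with measures
avoids any integrability requirement on `ε² φ(x)²`. -/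
theorem integral_mul_sq_eq (hε : MemLp (fun z : A × ℝ => z.2) 2 Q)
    (hhom : Q[fun z => z.2 ^ 2 | MeasurableSpace.comap (fun z : A × ℝ => z.1) inferInstance]
      =ᵐ[Q] fun _ => σ ^ 2) {φ : A → ℝ} (hφ : Measurable φ) :
    ∫ z, (z.2 * φ z.1) ^ 2 ∂Q = σ ^ 2 * ∫ z, φ z.1 ^ 2 ∂Q := by
  have h := congrArg (fun ν => ∫ a, φ a ^ 2 ∂ν) (map_fst_withDensity_sq hε hhom)
  simp only [integral_smul_measure] at h
  rw [integral_map (by fun_prop) (by fun_prop), integral_map (by fun_prop) (by fun_prop),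
    integral_withDensity_eq_integral_toReal_smul (by fun_prop) (by simp),
    ENNReal.toReal_ofReal (sq_nonneg _), smul_eq_mul] at h
  rw [← h]
  refine integral_congr_ae (ae_of_all _ fun z => ?_)
  simp only [ENNReal.toReal_ofReal (sq_nonneg z.2), smul_eq_mul]
  ring

/-- A product of two square-integrable variables is in general only integrable. Homoskedasticity
lifts it to `L²`, so that the score has a finite variance without fourth moments. -/
theorem memLp_two_mul (hε : MemLp (fun z : A × ℝ => z.2) 2 Q)
    (hhom : Q[fun z => z.2 ^ 2 | MeasurableSpace.comap (fun z : A × ℝ => z.1) inferInstance]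
      =ᵐ[Q] fun _ => σ ^ 2) {φ : A → ℝ} (hφ : Measurable φ)
    (hφ2 : MemLp (fun z : A × ℝ => φ z.1) 2 Q) :
    MemLp (fun z : A × ℝ => z.2 * φ z.1) 2 Q := by
  rw [memLp_two_iff_integrable_sq (by fun_prop)]
  have h1 : Integrable (fun a => φ a ^ 2) (ENNReal.ofReal (σ ^ 2) • Q.map Prod.fst) := by
    refine Integrable.smul_measure ?_ ENNReal.ofReal_ne_top
    rw [integrable_map_measure (by fun_prop) (by fun_prop)]
    exact hφ2.integrable_sq
  rw [← map_fst_withDensity_sq hε hhom, integrable_map_measure (by fun_prop) (by fun_prop),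
    integrable_withDensity_iff_integrable_smul' (by fun_prop) (by simp)] at h1
  refine h1.congr (ae_of_all _ fun z => ?_)
  simp only [ENNReal.toReal_ofReal (sq_nonneg z.2), smul_eq_mul, Function.comp_apply]
  ring

end Homoskedastic

/-! ### Moments of the design and quadratic forms -/

variable {K : ℕ} {Q : Measure (EuclideanSpace ℝ (Fin K) × ℝ)}

theorem memLp_two_apply (hQx : MemLp (fun z : EuclideanSpace ℝ (Fin K) × ℝ => z.1) 2 Q)
    (k : Fin K) : MemLp (fun z : EuclideanSpace ℝ (Fin K) × ℝ => z.1 k) 2 Q :=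
  (EuclideanSpace.proj (𝕜 := ℝ) k : EuclideanSpace ℝ (Fin K) →L[ℝ] ℝ).comp_memLp' hQx

theorem inner_eq_sum (v w : EuclideanSpace ℝ (Fin K)) : (inner ℝ v w : ℝ) = ∑ k, v k * w k := by
  simp [PiLp.inner_apply, mul_comm]

theorem memLp_two_inner (hQx : MemLp (fun z : EuclideanSpace ℝ (Fin K) × ℝ => z.1) 2 Q)
    (v : EuclideanSpace ℝ (Fin K)) :
    MemLp (fun z : EuclideanSpace ℝ (Fin K) × ℝ => (inner ℝ z.1 v : ℝ)) 2 Q :=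
  ((innerSL ℝ v).comp_memLp' hQx).congr_norm (by fun_prop) (ae_of_all _ fun z => by
    simp [real_inner_comm])

theorem integral_inner_sq (hQx : MemLp (fun z : EuclideanSpace ℝ (Fin K) × ℝ => z.1) 2 Q)
    (v : EuclideanSpace ℝ (Fin K)) :
    ∫ z, (inner ℝ z.1 v : ℝ) ^ 2 ∂Q = v ⬝ᵥ secondMoment Q *ᵥ v := by
  have hi : ∀ j k, Integrable (fun z : EuclideanSpace ℝ (Fin K) × ℝ =>
      v j * (z.1 j * z.1 k * v k)) Q := fun j k =>
    (((memLp_two_apply hQx j).integrable_mul (memLp_two_apply hQx k)).mul_const _).const_mul _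
  have e : ∀ z : EuclideanSpace ℝ (Fin K) × ℝ, (inner ℝ z.1 v : ℝ) ^ 2 =
      ∑ j, ∑ k, v j * (z.1 j * z.1 k * v k) := fun z => by
    rw [inner_eq_sum, sq, Finset.sum_mul_sum]
    exact Finset.sum_congr rfl fun _ _ => Finset.sum_congr rfl fun _ _ => by ring
  simp only [e]
  rw [integral_finsetSum _ fun j _ => integrable_finsetSum _ fun k _ => hi j k]
  simp only [dotProduct, Matrix.mulVec, Finset.mul_sum]
  refine Finset.sum_congr rfl fun j _ => ?_
  rw [integral_finsetSum _ fun k _ => hi j k]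
  refine Finset.sum_congr rfl fun k _ => ?_
  rw [integral_const_mul, integral_mul_const]
  rfl

theorem integral_mul_inner_eq_zero
    (hQx : MemLp (fun z : EuclideanSpace ℝ (Fin K) × ℝ => z.1) 2 Q)
    (hQε : MemLp (fun z : EuclideanSpace ℝ (Fin K) × ℝ => z.2) 2 Q)
    (hxε : ∀ k, ∫ z, z.1 k * z.2 ∂Q = 0) (v : EuclideanSpace ℝ (Fin K)) :
    ∫ z, z.2 * (inner ℝ z.1 v : ℝ) ∂Q = 0 := by
  have e : ∀ z : EuclideanSpace ℝ (Fin K) × ℝ, z.2 * (inner ℝ z.1 v : ℝ) =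
      ∑ k, z.1 k * z.2 * v k := fun z => by
    rw [inner_eq_sum, Finset.mul_sum]
    exact Finset.sum_congr rfl fun _ _ => by ring
  simp only [e]
  have hi : ∀ k, Integrable (fun z : EuclideanSpace ℝ (Fin K) × ℝ => z.1 k * z.2 * v k) Q :=
    fun k => ((memLp_two_apply hQx k).integrable_mul hQε).mul_const (v k)
  rw [integral_finsetSum _ fun k _ => hi k]
  simp [integral_mul_const, hxε]

/-- `c` is the minimum of the quadratic form over the compact unit sphere, extended by homogeneity;
the sphere is empty only in dimension zero. -/
theorem exists_pos_mul_sq_le_of_posDef {S : Matrix (Fin K) (Fin K) ℝ} (hS : S.PosDef) :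
    ∃ c : ℝ, 0 < c ∧ ∀ v : EuclideanSpace ℝ (Fin K), c * ‖v‖ ^ 2 ≤ v ⬝ᵥ S *ᵥ v := by
  rcases (Metric.sphere (0 : EuclideanSpace ℝ (Fin K)) 1).eq_empty_or_nonempty with he | hne
  · refine ⟨1, one_pos, fun v => ?_⟩
    have hv : v = 0 := by
      by_contra hv
      have : (‖v‖⁻¹ • v) ∈ Metric.sphere (0 : EuclideanSpace ℝ (Fin K)) 1 := by
        simp [norm_smul, hv]
      rw [he] at this
      exact this
    simp [hv]
  · have hcont : Continuous fun v : EuclideanSpace ℝ (Fin K) => v ⬝ᵥ S *ᵥ v := by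
      simp only [dotProduct, Matrix.mulVec]
      fun_prop
    obtain ⟨v₀, hv₀, hmin⟩ := (isCompact_sphere _ _).exists_isMinOn hne hcont.continuousOn
    have hv₀' : ‖v₀‖ = 1 := by simpa using hv₀
    refine ⟨v₀ ⬝ᵥ S *ᵥ v₀, ?_, fun v => ?_⟩
    · have := hS.dotProduct_mulVec_pos (x := (v₀ : Fin K → ℝ)) (by
        intro h0
        have : v₀ = 0 := by ext i; exact congrFun h0 i
        simp [this] at hv₀')
      simpa using this
    · by_cases hv : v = 0
      · simp [hv]
      have hn : 0 < ‖v‖ := norm_pos_iff.2 hv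
      have h1 := hmin (show (‖v‖⁻¹ • v) ∈ Metric.sphere (0 : EuclideanSpace ℝ (Fin K)) 1 by
        simp [norm_smul, hv])
      simp only [WithLp.ofLp_smul, Matrix.mulVec_smul, dotProduct_smul, smul_dotProduct,
        smul_eq_mul, Set.mem_ofPred_eq] at h1
      calc v₀ ⬝ᵥ S *ᵥ v₀ * ‖v‖ ^ 2
          ≤ ‖v‖⁻¹ * (‖v‖⁻¹ * (v ⬝ᵥ S *ᵥ v)) * ‖v‖ ^ 2 :=
            mul_le_mul_of_nonneg_right h1 (sq_nonneg _)
        _ = v ⬝ᵥ S *ᵥ v := by field_simp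

end Moments

/-! ### Perturbation of the normal equations -/

section Perturbation

variable {n K : ℕ}

theorem fitted_sub (X : Matrix (Fin n) (Fin K) ℝ) (v w : EuclideanSpace ℝ (Fin K)) :
    fitted X (v - w) = fitted X v - fitted X w := (fittedLinear X).map_sub v w

theorem fitted_smul (X : Matrix (Fin n) (Fin K) ℝ) (c : ℝ) (v : EuclideanSpace ℝ (Fin K)) :
    fitted X (c • v) = c • fitted X v := (fittedLinear X).map_smul c v

theorem fitted_sub_left (M N : Matrix (Fin n) (Fin K) ℝ) (v : EuclideanSpace ℝ (Fin K)) :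
    fitted (M - N) v = fitted M v - fitted N v := by
  ext i
  simp [fitted, Matrix.sub_mulVec]

theorem fitted_sampleSecondMoment (X : Matrix (Fin n) (Fin K) ℝ)
    (b : EuclideanSpace ℝ (Fin K)) :
    fitted (sampleSecondMoment X) b = (1 / (n : ℝ)) • fitted Xᵀ (fitted X b) := by
  ext i
  simp [fitted, sampleSecondMoment, Matrix.smul_mulVec]

theorem inner_fitted_self (S : Matrix (Fin K) (Fin K) ℝ) (b : EuclideanSpace ℝ (Fin K)) :
    (inner ℝ b (fitted S b) : ℝ) = b ⬝ᵥ S *ᵥ b := by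
  rw [inner_eq_sum]
  rfl

theorem norm_sq_fitted (hn : 0 < n) (X : Matrix (Fin n) (Fin K) ℝ)
    (b : EuclideanSpace ℝ (Fin K)) :
    ‖fitted X b‖ ^ 2 = n * inner ℝ b (fitted (sampleSecondMoment X) b) := by
  have : (n : ℝ) ≠ 0 := by positivity
  rw [← real_inner_self_eq_norm_sq, inner_fitted, fitted_sampleSecondMoment, inner_smul_right]
  field_simp

/-- The bound for transposed matrices followed by `‖v‖₁ ≤ √K ‖v‖`; symmetry serves only to identify
`M` with `Mᵀ`. -/
theorem norm_fitted_le_of_isSymm {M : Matrix (Fin K) (Fin K) ℝ} (hM : Mᵀ = M)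
    (v : EuclideanSpace ℝ (Fin K)) : ‖fitted M v‖ ≤ K * matSupNorm M * ‖v‖ := by
  have h1 := norm_fitted_transpose_le M v
  rw [hM] at h1
  have h2 : l1Norm v ≤ √(K : ℝ) * ‖v‖ := by
    have := sum_abs_le_sqrt_card_mul_norm Finset.univ v
    simpa [l1Norm] using this
  refine h1.trans ?_
  calc √(K : ℝ) * (matSupNorm M * l1Norm v)
      ≤ √(K : ℝ) * (matSupNorm M * (√(K : ℝ) * ‖v‖)) := by
        gcongr
        exact matSupNorm_nonneg M
    _ = (√(K : ℝ) * √(K : ℝ)) * matSupNorm M * ‖v‖ := by ring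
    _ = _ := by rw [Real.mul_self_sqrt (by positivity)]

theorem transpose_sampleSecondMoment_sub {S : Matrix (Fin K) (Fin K) ℝ} (hS : Sᵀ = S)
    (X : Matrix (Fin n) (Fin K) ℝ) :
    (sampleSecondMoment X - S)ᵀ = sampleSecondMoment X - S := by
  simp [sampleSecondMoment, Matrix.transpose_sub, Matrix.transpose_smul, Matrix.transpose_mul, hS]

/-- A design whose sample second moment is close to a positive definite matrix is well
conditioned. -/
theorem le_norm_sq_fitted (hn : 0 < n) {S : Matrix (Fin K) (Fin K) ℝ} (hS : Sᵀ = S) {c : ℝ}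
    (hc : ∀ v : EuclideanSpace ℝ (Fin K), c * ‖v‖ ^ 2 ≤ v ⬝ᵥ S *ᵥ v)
    {X : Matrix (Fin n) (Fin K) ℝ} (hX : K * matSupNorm (sampleSecondMoment X - S) ≤ c / 2)
    (b : EuclideanSpace ℝ (Fin K)) : n * (c / 2) * ‖b‖ ^ 2 ≤ ‖fitted X b‖ ^ 2 := by
  rw [norm_sq_fitted hn, mul_assoc]
  refine mul_le_mul_of_nonneg_left ?_ (by positivity)
  have h1 := hc b
  rw [← inner_fitted_self] at h1
  have h2 := norm_fitted_le_of_isSymm (transpose_sampleSecondMoment_sub hS X) b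
  have h3 := (abs_le.1 (abs_real_inner_le_norm b (fitted (sampleSecondMoment X - S) b))).1
  rw [fitted_sub_left, inner_sub_right] at h3
  rw [fitted_sub_left] at h2
  have h4 := mul_le_mul_of_nonneg_left h2 (norm_nonneg b)
  have h5 := mul_le_mul_of_nonneg_right hX (sq_nonneg ‖b‖)
  linarith

/-- Solutions of perturbed normal equations are close to the solutions of the limiting ones. -/
theorem norm_sub_le_of_normal_equations (hn : 0 < n) {S : Matrix (Fin K) (Fin K) ℝ}
    (hS : Sᵀ = S) (hdet : IsUnit S.det) {c : ℝ} (hc0 : 0 < c)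
    (hc : ∀ v : EuclideanSpace ℝ (Fin K), c * ‖v‖ ^ 2 ≤ v ⬝ᵥ S *ᵥ v)
    {X : Matrix (Fin n) (Fin K) ℝ} (hX : K * matSupNorm (sampleSecondMoment X - S) ≤ c / 2)
    {d : EuclideanSpace ℝ (Fin K)} {ε h : EuclideanSpace ℝ (Fin n)}
    (heq : fitted Xᵀ (fitted X d) = fitted Xᵀ ε - fitted Xᵀ h) :
    ‖√(n : ℝ) • d - fitted S⁻¹ ((√(n : ℝ))⁻¹ • fitted Xᵀ ε)‖ ≤
      c⁻¹ * ((√(n : ℝ))⁻¹ * ‖fitted Xᵀ h‖ + K * matSupNorm (sampleSecondMoment X - S) *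
        (2 / c * (‖(√(n : ℝ))⁻¹ • fitted Xᵀ ε‖ + (√(n : ℝ))⁻¹ * ‖fitted Xᵀ h‖))) := by
  have hr : (0 : ℝ) < √(n : ℝ) := by positivity
  have hnn : (n : ℝ) = √(n : ℝ) * √(n : ℝ) := (Real.mul_self_sqrt (by positivity)).symm
  set r := √(n : ℝ) with hr_def
  set D := matSupNorm (sampleSecondMoment X - S) with hD
  have hD0 : 0 ≤ D := matSupNorm_nonneg _
  set θ := r • d with hθ
  set s := r⁻¹ • fitted Xᵀ ε with hs
  set R := r⁻¹ * ‖fitted Xᵀ h‖ with hR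
  have hR0 : 0 ≤ R := by positivity
  have hRn : ‖r⁻¹ • fitted Xᵀ h‖ = R := by
    rw [norm_smul, Real.norm_of_nonneg (by positivity)]
  have hsam : fitted (sampleSecondMoment X) θ = s - r⁻¹ • fitted Xᵀ h := by
    rw [fitted_sampleSecondMoment, hθ, fitted_smul, fitted_smul, heq, smul_smul, hs, ← smul_sub]
    congr 1
    rw [hnn]
    field_simp
  -- An a priori bound on `θ` from the coercivity `c / 2` of the sample second moment; it controls
  -- the replacement of that matrix by `S` below.
  have hθn : ‖θ‖ ≤ 2 / c * (‖s‖ + R) := by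
    rcases (norm_nonneg θ).eq_or_lt with h0 | h0
    · rw [← h0]; positivity
    have h1 := le_norm_sq_fitted hn hS hc hX θ
    rw [norm_sq_fitted hn, mul_assoc] at h1
    replace h1 := le_of_mul_le_mul_left h1 (by positivity : (0 : ℝ) < n)
    rw [hsam] at h1
    have h2 : inner ℝ θ (s - r⁻¹ • fitted Xᵀ h) ≤ ‖θ‖ * (‖s‖ + R) :=
      (real_inner_le_norm _ _).trans (mul_le_mul_of_nonneg_left
        (by rw [← hRn]; exact norm_sub_le _ _) h0.le)
    have h3 : ‖θ‖ * (c / 2 * ‖θ‖) ≤ ‖θ‖ * (‖s‖ + R) := by linarith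
    have h4 := le_of_mul_le_mul_left h3 h0
    calc ‖θ‖ = 2 / c * (c / 2 * ‖θ‖) := by field_simp
      _ ≤ _ := mul_le_mul_of_nonneg_left h4 (by positivity)
  set w := fitted S⁻¹ s with hw
  have hSw : fitted S w = s := by
    ext i
    simp [hw, fitted, Matrix.mulVec_mulVec, Matrix.mul_nonsing_inv _ hdet]
  have hkey : fitted S (θ - w) = -(fitted (sampleSecondMoment X - S) θ) - r⁻¹ • fitted Xᵀ h := by
    rw [fitted_sub, hSw, fitted_sub_left, hsam]
    abel
  have hn1 : ‖fitted S (θ - w)‖ ≤ K * D * ‖θ‖ + R := by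
    rw [hkey, ← hRn]
    refine (norm_sub_le _ _).trans ?_
    rw [norm_neg]
    exact add_le_add (norm_fitted_le_of_isSymm (transpose_sampleSecondMoment_sub hS X) θ) le_rfl
  have h5 : c * ‖θ - w‖ ≤ K * D * ‖θ‖ + R := by
    rcases (norm_nonneg (θ - w)).eq_or_lt with h0 | h0
    · rw [← h0]; simp only [mul_zero]; positivity
    have h1 := hc (θ - w)
    rw [← inner_fitted_self] at h1
    have h2 := h1.trans (real_inner_le_norm _ _)
    have h3 := mul_le_mul_of_nonneg_left hn1 h0.le
    refine le_of_mul_le_mul_left ?_ h0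
    linarith
  have h6 : c * ‖θ - w‖ ≤ R + K * D * (2 / c * (‖s‖ + R)) := by
    have := mul_le_mul_of_nonneg_left hθn (by positivity : 0 ≤ K * D)
    linarith
  calc ‖θ - w‖ = c⁻¹ * (c * ‖θ - w‖) := by field_simp
    _ ≤ _ := mul_le_mul_of_nonneg_left h6 (by positivity)

/-- A diagonal entry of the sample second moment is at most the square of the largest entry. -/
theorem sampleSecondMoment_diag_le (X : Matrix (Fin n) (Fin K) ℝ) (k : Fin K) :
    sampleSecondMoment X k k ≤ matSupNorm X ^ 2 := by
  rcases Nat.eq_zero_or_pos n with rfl | hn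
  · simpa [sampleSecondMoment] using sq_nonneg (matSupNorm X)
  have h : ∑ i, X i k * X i k ≤ ∑ _i : Fin n, matSupNorm X ^ 2 := by
    refine Finset.sum_le_sum fun i _ => ?_
    rw [← sq, ← sq_abs]
    exact pow_le_pow_left₀ (abs_nonneg _) (abs_apply_le_matSupNorm X i k) 2
  have h' : (0 : ℝ) < n := by positivity
  simp only [sampleSecondMoment, Matrix.smul_apply, Matrix.mul_apply, Matrix.transpose_apply,
    smul_eq_mul]
  rw [one_div_mul_eq_div, div_le_iff₀ h']
  simpa [mul_comm] using h

theorem meanSquaredResidual_eq (X : Matrix (Fin n) (Fin K) ℝ) (y : EuclideanSpace ℝ (Fin n))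
    (b : EuclideanSpace ℝ (Fin K)) (a : EuclideanSpace ℝ (Fin n)) :
    meanSquaredResidual X y b a = 1 / (n : ℝ) * ‖y - fitted X b - a‖ ^ 2 := by
  rw [EuclideanSpace.real_norm_sq_eq]
  rfl

/-- Difference of squares: one factor is at most `‖g‖`, the other at most `‖g‖ + 2 ‖u‖ ≤ 6 ‖u‖`. -/
theorem abs_norm_sq_sub_sub_le {E : Type*} [NormedAddCommGroup E] {u g : E}
    (h : ‖g‖ ≤ 4 * ‖u‖) : |‖u - g‖ ^ 2 - ‖u‖ ^ 2| ≤ 6 * ‖g‖ * ‖u‖ := by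
  have h1 := norm_sub_le u g
  have h2 := norm_sub_norm_le u g
  have hg := norm_nonneg g
  have hu := norm_nonneg u
  have h3 : |‖u - g‖ - ‖u‖| ≤ ‖g‖ := abs_le.2 ⟨by linarith, by linarith⟩
  calc |‖u - g‖ ^ 2 - ‖u‖ ^ 2| = |‖u - g‖ - ‖u‖| * (‖u - g‖ + ‖u‖) := by
        rw [show ‖u - g‖ ^ 2 - ‖u‖ ^ 2 = (‖u - g‖ - ‖u‖) * (‖u - g‖ + ‖u‖) by ring, abs_mul,
          abs_of_nonneg (by positivity : 0 ≤ ‖u - g‖ + ‖u‖)]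
    _ ≤ ‖g‖ * (6 * ‖u‖) := mul_le_mul h3 (by linarith) (by positivity) hg
    _ = _ := by ring

theorem numNonzero_eq_sum_indicator {Ω : Type*} (α : Ω → EuclideanSpace ℝ (Fin n)) (ω : Ω) :
    (numNonzero (α ω) : ENNReal) = ∑ i, {ω | α ω i ≠ 0}.indicator (fun _ => (1 : ENNReal)) ω := by
  simp only [numNonzero, Set.indicator_apply, Set.mem_ofPred_eq, Finset.sum_boole]

end Perturbation

/-! ### Sparsity of the outlier vector -/

section Sparsity

variable {Ω : ℕ → Type*} [∀ n, MeasurableSpace (Ω n)] {μ : ∀ n, Measure (Ω n)}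
  {α : ∀ n, Ω n → EuclideanSpace ℝ (Fin n)} {p : ℕ → ℝ}

theorem nullMeasurableSet_apply_ne_zero {n : ℕ} (hα : AEMeasurable (α n) (μ n)) (i : Fin n) :
    NullMeasurableSet {ω | α n ω i ≠ 0} (μ n) := by
  have hαi : AEMeasurable (fun ω => α n ω i) (μ n) :=
    (EuclideanSpace.proj (𝕜 := ℝ) i : EuclideanSpace ℝ (Fin n) →L[ℝ] ℝ).continuous.measurable
      |>.comp_aemeasurable hα
  exact (hαi.nullMeasurableSet_preimage (measurableSet_singleton 0)).compl

theorem aemeasurable_numNonzero {n : ℕ} (hα : AEMeasurable (α n) (μ n)) :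
    AEMeasurable (fun ω => (numNonzero (α n ω) : ENNReal)) (μ n) := by
  simp only [numNonzero_eq_sum_indicator (α n)]
  exact Finset.aemeasurable_fun_sum _ fun i _ =>
    aemeasurable_const.indicator₀ (nullMeasurableSet_apply_ne_zero hα i)

/-- Linearity of expectation, so no assumption on the joint law of the `α_i` is needed. -/
theorem lintegral_numNonzero [∀ n, IsProbabilityMeasure (μ n)] {n : ℕ}
    (hα : AEMeasurable (α n) (μ n)) (hp : ∀ i : Fin n, (μ n).real {ω | α n ω i ≠ 0} = p n) :
    ∫⁻ ω, (numNonzero (α n ω) : ENNReal) ∂(μ n) = ENNReal.ofReal (n * p n) := by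
  have hset := nullMeasurableSet_apply_ne_zero hα
  simp only [numNonzero_eq_sum_indicator (α n)]
  rw [lintegral_finsetSum' _ fun i _ => aemeasurable_const.indicator₀ (hset i)]
  have hpe : ∀ i : Fin n, μ n {ω | α n ω i ≠ 0} = ENNReal.ofReal (p n) := fun i => by
    rw [← hp i, ofReal_measureReal]
  simp only [lintegral_indicator_const₀ (hset _), hpe, one_mul]
  simp [ENNReal.ofReal_mul]

theorem isBigOPOne_numNonzero_div [∀ n, IsProbabilityMeasure (μ n)]
    (hα : ∀ n, AEMeasurable (α n) (μ n))
    (hp : ∀ n (i : Fin n), (μ n).real {ω | α n ω i ≠ 0} = p n) :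
    IsBigOPOne μ fun n ω => (numNonzero (α n ω) : ℝ) / (n * p n) := by
  intro η hη
  obtain ⟨M, hM, hMη⟩ : ∃ M : ℝ, 0 < M ∧ ENNReal.ofReal M⁻¹ ≤ η := by
    have h1 : Tendsto (fun M : ℝ => ENNReal.ofReal M⁻¹) atTop (𝓝 0) := by
      rw [← ENNReal.ofReal_zero]
      exact ENNReal.tendsto_ofReal tendsto_inv_atTop_zero
    obtain ⟨M, h2, h3⟩ := ((ENNReal.tendsto_nhds_zero.1 h1 η hη).and
      (eventually_gt_atTop 0)).exists
    exact ⟨M, h3, h2⟩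
  refine ⟨M, hM, Eventually.of_forall fun n => le_trans ?_ hMη⟩
  have hnp : 0 ≤ n * p n := by
    rcases Nat.eq_zero_or_pos n with rfl | hn
    · simp
    · rw [← hp n ⟨0, hn⟩]; positivity
  -- When `n p = 0` the ratio is `0` by the convention on division and carries no information;
  -- `ae_numNonzero_eq_zero` handles that case separately.
  rcases hnp.eq_or_lt with h0 | h0
  · simp only [← h0, div_zero, abs_zero, hM.not_ge]
    simp
  have hmk := meas_ge_le_lintegral_div (aemeasurable_numNonzero (hα n))
    (ε := ENNReal.ofReal (M * (n * p n)))
    (ENNReal.ofReal_pos.2 (by positivity)).ne' ENNReal.ofReal_ne_top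
  rw [lintegral_numNonzero (hα n) (hp n), ← ENNReal.ofReal_div_of_pos (by positivity)] at hmk
  refine le_trans (measure_mono fun ω hω => ?_) (hmk.trans (le_of_eq ?_))
  · simp only [Set.mem_ofPred_eq] at hω ⊢
    rw [abs_of_nonneg (by positivity), le_div_iff₀ h0] at hω
    rw [← ENNReal.ofReal_natCast]
    exact ENNReal.ofReal_le_ofReal hω
  · congr 1
    rw [mul_comm M, ← div_div, div_self h0.ne', one_div]

theorem ae_numNonzero_eq_zero [∀ n, IsProbabilityMeasure (μ n)] {n : ℕ}
    (hp : ∀ i : Fin n, (μ n).real {ω | α n ω i ≠ 0} = p n)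
    (h0 : (n : ℝ) * p n = 0) : ∀ᵐ ω ∂(μ n), numNonzero (α n ω) = 0 := by
  have h : ∀ᵐ ω ∂(μ n), ∀ i : Fin n, α n ω i = 0 := by
    rw [ae_all_iff]
    intro i
    have hn : (n : ℝ) ≠ 0 := by
      have := i.pos
      positivity
    have hpi := hp i
    rw [(mul_eq_zero.1 h0).resolve_left hn, measureReal_eq_zero_iff] at hpi
    exact hpi
  filter_upwards [h] with ω hω
  simp [numNonzero, hω]

end Sparsity

/-! ### Consequences of the oracle inequalities -/

section Rates

variable {n K : ℕ}

theorem sqrt_mul_norm_le_of_sq_le {X : Matrix (Fin n) (Fin K) ℝ} {c : ℝ}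
    (hX : ∀ b, n * c * ‖b‖ ^ 2 ≤ ‖fitted X b‖ ^ 2) (b : EuclideanSpace ℝ (Fin K)) :
    √(n * c) * ‖b‖ ≤ ‖fitted X b‖ := by
  have h := Real.sqrt_le_sqrt (hX b)
  rwa [Real.sqrt_mul' _ (sq_nonneg _), Real.sqrt_sq (norm_nonneg _),
    Real.sqrt_sq (norm_nonneg _)] at h

/-- Rates for the score perturbation and the residual variance of the square-root lasso, in terms
of `lam ‖X‖_∞ ‖α‖₀ / √n`. -/
theorem IsSqrtLasso.rates {lam : ℝ} {X : Matrix (Fin n) (Fin K) ℝ}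
    {β b : EuclideanSpace ℝ (Fin K)} {α ε a : EuclideanSpace ℝ (Fin n)} (hn : 0 < n)
    (h : IsSqrtLasso lam X (outcome X β α ε) b a)
    (hpen : 2 * √(n : ℝ) * (vecSupNorm (residualMaker X ε) / ‖residualMaker X ε‖) ≤ lam)
    {c : ℝ} (hc : 0 < c) (hX : ∀ b, n * c * ‖b‖ ^ 2 ≤ ‖fitted X b‖ ^ 2)
    {σ : ℝ} (hσ : 0 < σ) (hu : |1 / (n : ℝ) * ‖residualMaker X ε‖ ^ 2 - σ ^ 2| < σ ^ 2 / 2)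
    {B₀ : ℝ} (hB₀ : 0 < B₀) (hB : B₀ ≤ matSupNorm X)
    (hT₁ : lam * matSupNorm X * numNonzero α / √(n : ℝ) ≤ B₀ / 4)
    (hT₂ : 4 * √(K : ℝ) * (lam * matSupNorm X * numNonzero α / √(n : ℝ)) ≤ √c) :
    (√(n : ℝ))⁻¹ * ‖fitted Xᵀ (a - α)‖ ≤
        256 * σ * √(K : ℝ) * (lam * matSupNorm X * numNonzero α / √(n : ℝ)) ∧
      |meanSquaredResidual X (outcome X β α ε) b a - 1 / (n : ℝ) * ‖residualMaker X ε‖ ^ 2| ≤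
        384 * σ ^ 2 / B₀ * (lam * matSupNorm X * numNonzero α / √(n : ℝ)) := by
  have hr : (0 : ℝ) < √(n : ℝ) := by positivity
  have hn' : (0 : ℝ) < n := by positivity
  have hnn : √(n : ℝ) * √(n : ℝ) = n := Real.mul_self_sqrt (by positivity)
  have hor := h.oracle (lam := lam) (c := √(n * c)) hn
  have hmsr : meanSquaredResidual X (outcome X β α ε) b a =
      1 / (n : ℝ) * ‖residualMaker X ε - residualMaker X (a - α)‖ ^ 2 := by
    rw [meanSquaredResidual_eq, h.residual_eq hn, residualMaker_outcome_sub]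
  rw [hmsr]
  set u := residualMaker X ε with hu_def
  set g := residualMaker X (a - α) with hg
  set B := matSupNorm X with hBdef
  set r := √(n : ℝ) with hr_def
  set s : ℝ := (numNonzero α : ℝ) with hs
  have hBpos : 0 < B := hB₀.trans_le hB
  have hs0 : 0 ≤ s := Nat.cast_nonneg _
  have hun := abs_lt.1 hu
  -- `3 σ² / 2` would do; `4 σ²` has the clean square root `2 σ`.
  have hun1 : ‖u‖ ^ 2 ≤ 4 * σ ^ 2 * n := by
    have h1 : 1 / (n : ℝ) * ‖u‖ ^ 2 ≤ 4 * σ ^ 2 := by nlinarith [hun.2]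
    rwa [one_div_mul_eq_div, div_le_iff₀ hn'] at h1
  have hupos : 0 < ‖u‖ := by
    rcases (norm_nonneg u).eq_or_lt with h0 | h0
    · rw [← h0] at hun
      nlinarith [hun.1, sq_pos_of_pos hσ]
    · exact h0
  have hur : ‖u‖ ≤ 2 * σ * r := by
    refine abs_le_of_sq_le_sq' ?_ (by positivity) |>.2
    rw [mul_pow, mul_pow, sq r, hnn]
    linarith
  -- Since `‖u‖ ≤ √n ‖u‖_∞`, the penalty condition alone keeps `lam` away from zero. With `√s ≤ s`
  -- for an integer `s` and `B₀ ≤ ‖X‖_∞`, this lets `T` control every smallness requirement of the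
  -- oracle inequality.
  have hlam : 2 ≤ lam := by
    refine le_trans ?_ hpen
    have h1 := norm_le_sqrt_mul_vecSupNorm u
    rw [mul_assoc, ← mul_div_assoc]
    have h2 : 1 ≤ r * vecSupNorm u / ‖u‖ := (one_le_div hupos).2 h1
    linarith
  have hlam0 : 0 < lam := by linarith
  set T := lam * B * s / r with hT
  have hT0 : 0 ≤ T := by positivity
  have hTr : T * r = lam * B * s := by rw [hT]; field_simp
  have hss : √s ≤ s := by
    rcases Nat.eq_zero_or_pos (numNonzero α) with h0 | h0
    · simp [hs, h0]
    · have h1 : 1 ≤ s := Nat.one_le_cast.2 h0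
      exact Real.sqrt_le_iff.2 ⟨hs0, by nlinarith⟩
  have hsmall : 8 * (√(K : ℝ) * B * √s) ≤ √(n * c) := by
    rw [Real.sqrt_mul hn'.le]
    calc 8 * (√(K : ℝ) * B * √s) ≤ 8 * (√(K : ℝ) * B * s) := by gcongr
      _ = 4 * √(K : ℝ) * (2 * B * s) := by ring
      _ ≤ 4 * √(K : ℝ) * (lam * B * s) := by gcongr
      _ = (4 * √(K : ℝ) * T) * r := by rw [← hTr]; ring
      _ ≤ √c * r := by gcongr
      _ = r * √c := by ring
  have htau : lam * √s / r ≤ T / B₀ := by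
    rw [div_le_iff₀ hr, div_mul_eq_mul_div, le_div_iff₀ hB₀, hTr]
    calc lam * √s * B₀ ≤ lam * s * B := by gcongr
      _ = _ := by ring
  have htau4 : lam * √s / r ≤ 1 / 4 := by
    refine htau.trans ?_
    rw [div_le_iff₀ hB₀]
    linarith
  obtain ⟨h1, h2⟩ := hor hlam0 (norm_pos_iff.1 hupos) hpen (by positivity)
    (sqrt_mul_norm_le_of_sq_le hX) hsmall htau4
  constructor
  -- `256 = 128 · 2`, from the `ℓ₁` oracle bound and `‖u‖ ≤ 2 σ r`.
  · calc r⁻¹ * ‖fitted Xᵀ (a - α)‖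
        ≤ r⁻¹ * (√(K : ℝ) * (B * (128 * (lam * s / r) * (2 * σ * r)))) := by
          gcongr
          refine (norm_fitted_transpose_le X _).trans ?_
          gcongr
          refine h2.trans ?_
          gcongr
      _ = 256 * σ * √(K : ℝ) * T := by rw [hT]; field_simp; ring
  · have hg4 : ‖g‖ ≤ 4 * ‖u‖ := by
      refine h1.trans ?_
      have := mul_le_mul_of_nonneg_right htau4 hupos.le
      linarith
    rw [← mul_sub, abs_mul, abs_of_pos (by positivity : (0 : ℝ) < 1 / n)]
    -- `384 = 6 · 16 · 4`: difference of squares, oracle bound, and `‖u‖² ≤ 4 σ² n`.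
    calc 1 / (n : ℝ) * |‖u - g‖ ^ 2 - ‖u‖ ^ 2| ≤ 1 / (n : ℝ) * (6 * ‖g‖ * ‖u‖) := by
          gcongr
          exact abs_norm_sq_sub_sub_le hg4
      _ ≤ 1 / (n : ℝ) * (6 * (16 * (T / B₀) * ‖u‖) * ‖u‖) := by
          gcongr
          refine h1.trans ?_
          gcongr
      _ = 96 * (T / B₀) * (1 / (n : ℝ)) * ‖u‖ ^ 2 := by ring
      _ ≤ 96 * (T / B₀) * (1 / (n : ℝ)) * (4 * σ ^ 2 * n) := by gcongr
      _ = 384 * σ ^ 2 / B₀ * T := by field_simp; ring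

end Rates

/-! ### Sample moments of the regression model -/

section SampleMoments

variable {K : ℕ} {Q : Measure (EuclideanSpace ℝ (Fin K) × ℝ)} [IsProbabilityMeasure Q]
  {Ω : ℕ → Type*} [∀ n, MeasurableSpace (Ω n)] {μ : ∀ n, Measure (Ω n)}
  {x : ∀ n, Ω n → Fin n → EuclideanSpace ℝ (Fin K)} {ε : ∀ n, Ω n → EuclideanSpace ℝ (Fin n)}

theorem isLittleOPOne_of_tendsto {a : ℕ → ℝ} (ha : Tendsto a atTop (𝓝 0)) :
    IsLittleOPOne μ fun n _ => a n := by
  intro δ hδ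
  have h : ∀ᶠ n in atTop, |a n| < δ := by
    have := ha.abs
    rw [abs_zero] at this
    exact this.eventually (gt_mem_nhds hδ)
  refine tendsto_const_nhds.congr' (h.mono fun n hn => ?_)
  simp [hn.not_ge]

theorem isLittleOPOne_sampleSecondMoment_sub
    (hQx : MemLp (fun z : EuclideanSpace ℝ (Fin K) × ℝ => z.1) 2 Q)
    (hlaw : ∀ n (i : Fin n), HasLaw (fun ω => (x n ω i, ε n ω i)) Q (μ n))
    (hindep : ∀ n, iIndepFun (fun (i : Fin n) ω => (x n ω i, ε n ω i)) (μ n)) :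
    IsLittleOPOne μ fun n ω =>
      matSupNorm (sampleSecondMoment (designMatrix (x n ω)) - secondMoment Q) := by
  have hjk : ∀ j k : Fin K, IsLittleOPOne μ fun n ω =>
      (sampleSecondMoment (designMatrix (x n ω)) - secondMoment Q) j k := fun j k => by
    have h := isLittleOPOne_average_sub (z := fun n ω i => (x n ω i, ε n ω i)) hlaw hindep
      (f := fun z => z.1 j * z.1 k) (by fun_prop)
      ((memLp_two_apply hQx j).integrable_mul (memLp_two_apply hQx k))
    simpa [sampleSecondMoment, secondMoment, designMatrix, Matrix.mul_apply] using h
  have hsum := IsLittleOPOne.finset_sum Finset.univ fun j _ =>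
    IsLittleOPOne.finset_sum Finset.univ fun k _ => (hjk j k).abs
  refine hsum.of_le (E := fun _ => Set.univ) (.of_ae fun n => by simp)
    (Eventually.of_forall fun n ω _ => ?_)
  rw [abs_of_nonneg (matSupNorm_nonneg _)]
  exact (matSupNorm_le_sum _).trans (le_abs_self _)

theorem fitted_transpose_designMatrix {n : ℕ} (x : Fin n → EuclideanSpace ℝ (Fin K))
    (v : EuclideanSpace ℝ (Fin n)) : fitted (designMatrix x)ᵀ v = ∑ i, v i • x i := by
  ext k
  simp [fitted, designMatrix, Matrix.mulVec, dotProduct, mul_comm]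

theorem isBigOPOne_norm_score [∀ n, IsProbabilityMeasure (μ n)]
    (hQx : MemLp (fun z : EuclideanSpace ℝ (Fin K) × ℝ => z.1) 2 Q)
    (hQε : MemLp (fun z : EuclideanSpace ℝ (Fin K) × ℝ => z.2) 2 Q)
    (hxε : ∀ k, ∫ z, z.1 k * z.2 ∂Q = 0) {σ : ℝ}
    (hhom : Q[fun z => z.2 ^ 2 |
        MeasurableSpace.comap (fun z : EuclideanSpace ℝ (Fin K) × ℝ => z.1) inferInstance]
      =ᵐ[Q] fun _ => σ ^ 2)
    (hlaw : ∀ n (i : Fin n), HasLaw (fun ω => (x n ω i, ε n ω i)) Q (μ n))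
    (hindep : ∀ n, iIndepFun (fun (i : Fin n) ω => (x n ω i, ε n ω i)) (μ n)) :
    IsBigOPOne μ fun (n : ℕ) ω =>
      ‖(√(n : ℝ))⁻¹ • fitted (designMatrix (x n ω))ᵀ (ε n ω)‖ := by
  have hk : ∀ k : Fin K, IsBigOPOne μ fun (n : ℕ) ω =>
      ((√(n : ℝ))⁻¹ • fitted (designMatrix (x n ω))ᵀ (ε n ω)) k := fun k => by
    have h := isBigOPOne_normalized_sum (z := fun n ω i => (x n ω i, ε n ω i)) hlaw hindep
      (f := fun z => z.2 * z.1 k) (by fun_prop)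
      (memLp_two_mul hQε hhom (φ := fun v => v k) (by fun_prop) (memLp_two_apply hQx k))
      (by simpa [mul_comm] using hxε k)
    simpa [fitted_transpose_designMatrix] using h
  refine (IsBigOPOne.finset_sum Finset.univ fun k _ => (hk k).abs).of_le fun n ω => ?_
  rw [abs_norm]
  refine le_trans ?_ (le_abs_self _)
  set v := (√(n : ℝ))⁻¹ • fitted (designMatrix (x n ω))ᵀ (ε n ω)
  have hnn : 0 ≤ ∑ k, |v k| := Finset.sum_nonneg fun _ _ => abs_nonneg _
  refine abs_le_of_sq_le_sq' ?_ hnn |>.2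
  rw [EuclideanSpace.real_norm_sq_eq]
  simp only [← sq_abs (v _)]
  exact Finset.sum_sq_le_sq_sum_of_nonneg fun _ _ => abs_nonneg _

/-- The central limit theorem for the summands `ε_i Σ⁻¹ x_i`. Homoskedasticity collapses their
sandwich covariance: `Σ⁻¹ (σ² Σ) Σ⁻¹ = σ² Σ⁻¹`. -/
theorem tendstoInDistribution_score [∀ n, IsProbabilityMeasure (μ n)]
    (hQx : MemLp (fun z : EuclideanSpace ℝ (Fin K) × ℝ => z.1) 2 Q)
    (hQε : MemLp (fun z : EuclideanSpace ℝ (Fin K) × ℝ => z.2) 2 Q)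
    (hSig : (secondMoment Q).PosDef)
    (hxε : ∀ k, ∫ z, z.1 k * z.2 ∂Q = 0) {σ : ℝ}
    (hhom : Q[fun z => z.2 ^ 2 |
        MeasurableSpace.comap (fun z : EuclideanSpace ℝ (Fin K) × ℝ => z.1) inferInstance]
      =ᵐ[Q] fun _ => σ ^ 2)
    (hlaw : ∀ n (i : Fin n), HasLaw (fun ω => (x n ω i, ε n ω i)) Q (μ n))
    (hindep : ∀ n, iIndepFun (fun (i : Fin n) ω => (x n ω i, ε n ω i)) (μ n)) :
    TendstoInDistribution
      (fun (n : ℕ) ω => fitted (secondMoment Q)⁻¹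
        ((√(n : ℝ))⁻¹ • fitted (designMatrix (x n ω))ᵀ (ε n ω))) atTop
      (fun v : EuclideanSpace ℝ (Fin K) => v) μ
      (multivariateGaussian 0 (σ ^ 2 • (secondMoment Q)⁻¹)) := by
  set S := secondMoment Q with hS
  have hdet : IsUnit S.det := (Matrix.isUnit_iff_isUnit_det S).1 hSig.isUnit
  have hSt : (S⁻¹)ᵀ = S⁻¹ := by
    have := hSig.inv.isHermitian
    simpa [Matrix.IsHermitian, Matrix.conjTranspose_eq_transpose_of_trivial] using this
  have hinner : ∀ z : EuclideanSpace ℝ (Fin K) × ℝ, ∀ t,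
      (inner ℝ (z.2 • fitted S⁻¹ z.1) t : ℝ) = z.2 * inner ℝ z.1 (fitted S⁻¹ t) := fun z t => by
    rw [inner_smul_left, inner_fitted, hSt]
    rfl
  have hmeas : Measurable fun v : EuclideanSpace ℝ (Fin K) => fitted S⁻¹ v :=
    (fittedLinear S⁻¹).continuous_of_finiteDimensional.measurable
  have hclt := tendstoInDistribution_normalized_sum (μ := μ)
    (z := fun n ω i => (x n ω i, ε n ω i)) hlaw hindep
    (f := fun z => z.2 • fitted S⁻¹ z.1) (V := σ ^ 2 • S⁻¹)
    (measurable_snd.smul (hmeas.comp measurable_fst))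
    (fun t => by
      simp only [hinner]
      exact memLp_two_mul hQε hhom (φ := fun v => inner ℝ v (fitted S⁻¹ t)) (by fun_prop)
        (memLp_two_inner hQx _))
    (fun t => by
      simp only [hinner]
      exact integral_mul_inner_eq_zero hQx hQε hxε _)
    (hSig.inv.posSemidef.smul (sq_nonneg σ))
    (fun t => by
      simp only [hinner]
      rw [integral_mul_sq_eq hQε hhom (φ := fun v => inner ℝ v (fitted S⁻¹ t)) (by fun_prop),
        integral_inner_sq hQx, ← hS, ← inner_fitted_self, inner_fitted, hSt]
      have : fitted S⁻¹ (fitted S (fitted S⁻¹ t)) = fitted S⁻¹ t := by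
        ext i
        simp [fitted, Matrix.mulVec_mulVec, Matrix.mul_nonsing_inv _ hdet]
      rw [this, inner_fitted_self, Matrix.smul_mulVec, dotProduct_smul, smul_eq_mul])
  convert! hclt using 3 with n ω
  rw [fitted_smul, fitted_transpose_designMatrix]
  congr 1
  have := map_sum (fittedLinear S⁻¹) (fun i => ε n ω i • x n ω i) Finset.univ
  refine this.trans (Finset.sum_congr rfl fun i _ => ?_)
  exact (fittedLinear S⁻¹).map_smul _ _

end SampleMoments

end OutlierRegression

end

/-! ### Asymptotic normality and consistency -/

theorem theorem2
    -- a fixed, nonzero number of regressors, and the true slope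
    {K : ℕ} (hK : 0 < K) (β : EuclideanSpace ℝ (Fin K))
    -- the joint law `Q` of `(x_i, ε_i)`, which does not depend on the sample size
    (Q : Measure (EuclideanSpace ℝ (Fin K) × ℝ)) [IsProbabilityMeasure Q]
    (hQx : MemLp (fun z : EuclideanSpace ℝ (Fin K) × ℝ => z.1) 2 Q)
    (hQε : MemLp (fun z : EuclideanSpace ℝ (Fin K) × ℝ => z.2) 2 Q)
    (hSig : (secondMoment Q).PosDef)
    (hε : ∫ z, z.2 ∂Q = 0)
    (hxε : ∀ k, ∫ z, z.1 k * z.2 ∂Q = 0)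
    (σ : ℝ) (hσ : 0 < σ)
    (hhom : Q[fun z => z.2 ^ 2 |
        MeasurableSpace.comap (fun z : EuclideanSpace ℝ (Fin K) × ℝ => z.1) inferInstance]
      =ᵐ[Q] fun _ => σ ^ 2)
    -- for each sample size `n`, a probability space carrying the data
    {Ω : ℕ → Type*} [∀ n, MeasurableSpace (Ω n)]
    (μ : ∀ n, Measure (Ω n)) [∀ n, IsProbabilityMeasure (μ n)]
    (x : ∀ n, Ω n → Fin n → EuclideanSpace ℝ (Fin K))
    (ε : ∀ n, Ω n → EuclideanSpace ℝ (Fin n))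
    (hlaw : ∀ n (i : Fin n), HasLaw (fun ω => (x n ω i, ε n ω i)) Q (μ n))
    (hindep : ∀ n, iIndepFun (fun (i : Fin n) ω => (x n ω i, ε n ω i)) (μ n))
    -- the outlier vector, arbitrarily dependent on `(x, ε)`, and the contamination level
    (α : ∀ n, Ω n → EuclideanSpace ℝ (Fin n)) (hα : ∀ n, AEMeasurable (α n) (μ n))
    (p : ℕ → ℝ) (hp : ∀ n (i : Fin n), (μ n).real {ω | α n ω i ≠ 0} = p n)
    -- the penalty level, possibly random
    (lam : ∀ n, Ω n → ℝ) (hlam : ∀ n, AEMeasurable (lam n) (μ n))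
    -- the square-root lasso estimator
    (βhat : ∀ n, Ω n → EuclideanSpace ℝ (Fin K)) (hβhat : ∀ n, AEMeasurable (βhat n) (μ n))
    (αhat : ∀ n, Ω n → EuclideanSpace ℝ (Fin n)) (hαhat : ∀ n, AEMeasurable (αhat n) (μ n))
    (hest : ∀ n, ∀ᵐ ω ∂(μ n), IsSqrtLasso (lam n ω) (designMatrix (x n ω))
      (outcome (designMatrix (x n ω)) β (α n ω) (ε n ω)) (βhat n ω) (αhat n ω))
    -- the penalty condition
    (hpen : WithProbApproachingOne μ fun n => {ω |
      2 * √(n : ℝ) * (vecSupNorm (residualMaker (designMatrix (x n ω)) (ε n ω)) /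
        ‖residualMaker (designMatrix (x n ω)) (ε n ω)‖) ≤ lam n ω})
    -- the rate conditions
    (hrate₁ : IsLittleOPOne μ fun n ω =>
      p n * max (lam n ω) (√(matSupNorm (designMatrix (x n ω)))))
    (hrate₂ : IsLittleOPOne μ fun n ω =>
      p n * lam n ω * matSupNorm (designMatrix (x n ω)) * √(n : ℝ)) :
    TendstoInDistribution (fun (n : ℕ) ω => √(n : ℝ) • (βhat n ω - β)) atTop
        (fun v : EuclideanSpace ℝ (Fin K) => v) μ
        (multivariateGaussian 0 (σ ^ 2 • (secondMoment Q)⁻¹)) ∧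
      IsLittleOPOne μ (fun n ω =>
        meanSquaredResidual (designMatrix (x n ω))
          (outcome (designMatrix (x n ω)) β (α n ω) (ε n ω)) (βhat n ω) (αhat n ω) - σ ^ 2) ∧
      IsLittleOPOne μ (fun n ω =>
        matSupNorm (sampleSecondMoment (designMatrix (x n ω)) - secondMoment Q)) := by
  have hn0 : WithProbApproachingOne μ fun n => {_ω | 0 < n} :=
    (WithProbApproachingOne.of_ae (E := fun _ => Set.univ) fun n => by simp).mono
      ((eventually_gt_atTop 0).mono fun n hn ω _ => hn)
  obtain ⟨c, hc, hcS⟩ := exists_pos_mul_sq_le_of_posDef hSig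
  have hKpos : (0 : ℝ) < K := by positivity
  have hSt : (secondMoment Q)ᵀ = secondMoment Q := by
    have := hSig.isHermitian
    simpa [Matrix.IsHermitian, Matrix.conjTranspose_eq_transpose_of_trivial] using this
  have hdet : IsUnit (secondMoment Q).det :=
    (Matrix.isUnit_iff_isUnit_det _).1 hSig.isUnit
  set S := secondMoment Q with hS_def
  set k₀ : Fin K := ⟨0, hK⟩
  have hS00 : 0 < S k₀ k₀ := hSig.diag_pos
  -- A diagonal entry of `XᵀX / n` is at most `‖X‖_∞²` and converges to `S k₀ k₀ > 0`; half of the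
  -- limit is an eventual lower bound.
  set B₀ := √(S k₀ k₀ / 2) with hB₀_def
  have hB₀ : 0 < B₀ := by positivity
  have hD := isLittleOPOne_sampleSecondMoment_sub hQx hlaw hindep
  have hE := isLittleOPOne_average_sub (z := fun n ω i => (x n ω i, ε n ω i)) hlaw hindep
    (f := fun z => z.2 ^ 2) (by fun_prop) hQε.integrable_sq
  rw [integral_sq_eq hhom] at hE
  have hS := isBigOPOne_norm_score hQx hQε hxε hhom hlaw hindep
  have hestev : WithProbApproachingOne μ fun n => {ω | IsSqrtLasso (lam n ω)
      (designMatrix (x n ω)) (outcome (designMatrix (x n ω)) β (α n ω) (ε n ω)) (βhat n ω)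
      (αhat n ω)} := WithProbApproachingOne.of_ae hest
  -- the design is well conditioned and bounded away from zero
  have hcond : WithProbApproachingOne μ fun n => {ω |
      K * matSupNorm (sampleSecondMoment (designMatrix (x n ω)) - S) ≤ c / 2} := by
    refine (hD.abs_lt (by positivity : 0 < c / 2 / K)).mono
      (Eventually.of_forall fun n ω hω => ?_)
    simp only [Set.mem_ofPred_eq] at hω ⊢
    have h1 := (le_abs_self _).trans hω.le
    rwa [le_div_iff₀' hKpos] at h1
  have hBev : WithProbApproachingOne μ fun n => {ω | B₀ ≤ matSupNorm (designMatrix (x n ω))} := by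
    refine (hD.abs_lt (half_pos hS00)).mono (Eventually.of_forall fun n ω hω => ?_)
    simp only [Set.mem_ofPred_eq] at hω ⊢
    have h1 := (le_abs_self _).trans_lt hω
    have h2 := (abs_le.1 (abs_apply_le_matSupNorm
      (sampleSecondMoment (designMatrix (x n ω)) - S) k₀ k₀)).1
    have h3 := sampleSecondMoment_diag_le (designMatrix (x n ω)) k₀
    rw [Matrix.sub_apply] at h2
    exact Real.sqrt_le_iff.2 ⟨matSupNorm_nonneg _, by linarith⟩
  -- the residual variance of the noise
  have hP : IsLittleOPOne μ fun n ω =>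
      1 / (n : ℝ) * ‖(columnSpan (designMatrix (x n ω))).starProjection (ε n ω)‖ ^ 2 := by
    have hinv : IsLittleOPOne μ fun (n : ℕ) _ => (√(n : ℝ))⁻¹ :=
      isLittleOPOne_of_tendsto (tendsto_inv_atTop_zero.comp
        (Real.tendsto_sqrt_atTop.comp tendsto_natCast_atTop_atTop))
    -- This is `‖Xᵀ ε‖ / n = o_P(1)`, and coercivity gives `‖P_X ε‖² / n ≤ (2 / c) (‖Xᵀ ε‖ / n)²`.
    have hs := hinv.mul_isBigOPOne hS
    refine ((hs.mul hs).mul_const (2 / c)).of_le (hn0.inter hcond)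
      (Eventually.of_forall fun n ω hω => ?_)
    obtain ⟨hn, hω⟩ := hω
    have hn : 0 < n := hn
    have hn' : (0 : ℝ) < n := by positivity
    have h1 := norm_starProjection_le (c := √(n * (c / 2))) (by positivity)
      (sqrt_mul_norm_le_of_sq_le (le_norm_sq_fitted hn hSt hcS hω)) (ε n ω)
    have h2 := pow_le_pow_left₀ (by positivity) h1 2
    rw [mul_pow, Real.sq_sqrt (by positivity)] at h2
    refine le_trans ?_ (le_abs_self _)
    rw [abs_of_nonneg (by positivity), norm_smul, Real.norm_of_nonneg (by positivity)]
    have hsq : ((√(n : ℝ))⁻¹) ^ 2 = (n : ℝ)⁻¹ := by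
      rw [inv_pow, Real.sq_sqrt hn'.le]
    calc 1 / (n : ℝ) * ‖(columnSpan (designMatrix (x n ω))).starProjection (ε n ω)‖ ^ 2
        = (n : ℝ)⁻¹ ^ 2 * (2 / c) * (n * (c / 2) *
          ‖(columnSpan (designMatrix (x n ω))).starProjection (ε n ω)‖ ^ 2) := by field_simp
      _ ≤ (n : ℝ)⁻¹ ^ 2 * (2 / c) * ‖fitted (designMatrix (x n ω))ᵀ (ε n ω)‖ ^ 2 := by gcongr
      _ = _ := by rw [← hsq]; ring
  have hV : IsLittleOPOne μ fun n ω =>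
      1 / (n : ℝ) * ‖residualMaker (designMatrix (x n ω)) (ε n ω)‖ ^ 2 - σ ^ 2 := by
    have h := hE.add (hP.mul_const (-1))
    convert h using 3 with n ω
    rw [norm_sq_residualMaker, EuclideanSpace.real_norm_sq_eq (ε n ω)]
    ring
  -- the sparsity rate
  have hT : IsLittleOPOne μ fun n ω =>
      lam n ω * matSupNorm (designMatrix (x n ω)) * numNonzero (α n ω) / √(n : ℝ) := by
    have hae : ∀ n : ℕ, ∀ᵐ ω ∂(μ n), ω ∈ {ω | (n : ℝ) * p n = 0 → numNonzero (α n ω) = 0} := by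
      intro n
      by_cases h0 : (n : ℝ) * p n = 0
      · filter_upwards [ae_numNonzero_eq_zero (hp n) h0] with ω hω _ using hω
      · exact ae_of_all _ fun ω h => absurd h h0
    -- `T` is the product of `p λ ‖X‖_∞ √n` and `s / (n p)`; if `n p = 0`, then `s = 0` almost
    -- surely and `T` vanishes.
    refine (hrate₂.mul_isBigOPOne (isBigOPOne_numNonzero_div hα hp)).of_le
      (WithProbApproachingOne.of_ae hae) (Eventually.of_forall fun n ω hω => ?_)
    by_cases h0 : (n : ℝ) * p n = 0
    · rw [hω h0]
      simp
    · have hn' : (0 : ℝ) < n := lt_of_le_of_ne (Nat.cast_nonneg n) (Ne.symm (left_ne_zero_of_mul h0))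
      have hp0 : p n ≠ 0 := right_ne_zero_of_mul h0
      have hr : √(n : ℝ) ≠ 0 := by positivity
      refine le_of_eq (congrArg abs ?_)
      rw [div_eq_iff hr]
      have hnn : √(n : ℝ) * √(n : ℝ) = n := Real.mul_self_sqrt (by positivity)
      calc lam n ω * matSupNorm (designMatrix (x n ω)) * (numNonzero (α n ω) : ℝ)
          = lam n ω * matSupNorm (designMatrix (x n ω)) * (numNonzero (α n ω) : ℝ) *
            (p n * n / (n * p n)) := by rw [mul_comm (p n), div_self h0, mul_one]
        _ = _ := by
          nth_rewrite 1 [← hnn]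
          ring
  set T := fun n ω =>
      lam n ω * matSupNorm (designMatrix (x n ω)) * numNonzero (α n ω) / √(n : ℝ) with hT_def
  have hT₁ : WithProbApproachingOne μ fun n => {ω | T n ω ≤ B₀ / 4} :=
    (hT.abs_lt (by positivity : 0 < B₀ / 4)).mono
      (Eventually.of_forall fun n ω hω => by
        simp only [Set.mem_ofPred_eq] at hω ⊢
        exact (le_abs_self _).trans hω.le)
  have hT₂ : WithProbApproachingOne μ fun n => {ω | 4 * √(K : ℝ) * T n ω ≤ √(c / 2)} := by
    refine (hT.abs_lt (by positivity : 0 < √(c / 2) / (4 * √(K : ℝ)))).mono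
      (Eventually.of_forall fun n ω hω => ?_)
    simp only [Set.mem_ofPred_eq] at hω ⊢
    have h1 := (le_abs_self _).trans hω.le
    rwa [le_div_iff₀' (by positivity)] at h1
  have hVev := hV.abs_lt (by positivity : 0 < σ ^ 2 / 2)
  have hrates : WithProbApproachingOne μ fun n => {ω |
      (√(n : ℝ))⁻¹ * ‖fitted (designMatrix (x n ω))ᵀ (αhat n ω - α n ω)‖ ≤
        256 * σ * √(K : ℝ) * T n ω ∧
      |meanSquaredResidual (designMatrix (x n ω))
          (outcome (designMatrix (x n ω)) β (α n ω) (ε n ω)) (βhat n ω) (αhat n ω) -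
          1 / (n : ℝ) * ‖residualMaker (designMatrix (x n ω)) (ε n ω)‖ ^ 2| ≤
        384 * σ ^ 2 / B₀ * T n ω} := by
    refine ((hn0.inter (hcond.inter hestev)).inter
      ((hBev.inter (hpen.inter hVev)).inter (hT₁.inter hT₂))).mono
        (Eventually.of_forall fun n ω hω => ?_)
    obtain ⟨⟨hn, hcω, heω⟩, ⟨hBω, hpω, hVω⟩, hT₁ω, hT₂ω⟩ := hω
    exact IsSqrtLasso.rates (n := n) hn heω hpω (half_pos hc)
      (le_norm_sq_fitted hn hSt hcS hcω) hσ hVω hB₀ hBω hT₁ω hT₂ω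
  have hR : IsLittleOPOne μ fun n ω =>
      (√(n : ℝ))⁻¹ * ‖fitted (designMatrix (x n ω))ᵀ (αhat n ω - α n ω)‖ := by
    refine (hT.mul_const (256 * σ * √(K : ℝ))).of_le hrates
      (Eventually.of_forall fun n ω hω => ?_)
    rw [abs_of_nonneg (by positivity), mul_comm (T n ω)]
    exact hω.1.trans (le_abs_self _)
  refine ⟨?_, ?_, hD⟩
  · refine tendstoInDistribution_of_isLittleOPOne_norm_sub
      (tendstoInDistribution_score hQx hQε hSig hxε hhom hlaw hindep)
      (fun n => AEMeasurable.fun_const_smul ((hβhat n).sub_const β) _) ?_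
    -- The bound of `norm_sub_le_of_normal_equations`: the bias and the matrix error are `o_P(1)`,
    -- the latter multiplied by a score that is only `O_P(1)`.
    have h1 := (hR.add ((hD.mul_const K).mul_isBigOPOne
      (((hS.add hR.isBigOPOne).mul_const (2 / c))))).mul_const c⁻¹
    refine h1.of_le (hn0.inter (hcond.inter hestev))
      (Eventually.of_forall fun n ω hω => ?_)
    rw [abs_norm]
    refine le_trans ?_ (le_abs_self _)
    refine (norm_sub_le_of_normal_equations hω.1 hSt hdet hc hcS hω.2.1
      (hω.2.2.normal_equations hω.1)).trans (le_of_eq ?_)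
    ring
  · have hdiff : IsLittleOPOne μ fun n ω =>
        meanSquaredResidual (designMatrix (x n ω))
          (outcome (designMatrix (x n ω)) β (α n ω) (ε n ω)) (βhat n ω) (αhat n ω) -
          1 / (n : ℝ) * ‖residualMaker (designMatrix (x n ω)) (ε n ω)‖ ^ 2 := by
      refine (hT.mul_const (384 * σ ^ 2 / B₀)).of_le hrates
        (Eventually.of_forall fun n ω hω => ?_)
      rw [mul_comm (T n ω)]
      exact hω.2.trans (le_abs_self _)
    simpa using hdiff.add hV
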